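/- **Box search with imperfect detection and a prediction.** Let $Y=\{1,\dots,n\}$ be a set of boxes, let $t_j>0$ be the time needed to search box $j$, and let $0<q<1$. A Hider hides in one box. A pure search is an infinite sequence of boxes; the boxes are searched in this order, and each time the box containing the Hider is searched, the Hider is found with probability $q$, independently of all other looks. A mixed search $s$ is a probability distribution with finite support on the pure searches. Let $u(s,j)\in[0,\infty]$ be the expected total time of the looks up to and including the one that finds the Hider, if the Hider is in box $j$; for a probability distribution $h$ on $Y$ put $u(s,h)=\sum_j h(j)u(s,j)$. For $Z\subseteq Y$ let $Z^c=Y\setminus Z$ and $t(Z)=\sum_{j\in Z}t_j$, and for $Z\ne\emptyset$ let $$V_q(Z)=\frac{t(Z)}{q}-\frac{\sum_{i<j,\ i,j\in Z}t_it_j}{t(Z)} .$$ Fix a prediction $H$ with $\emptyset\neq H\subsetneq Y$. The consistency and the robustness of a mixed search $s$ are $C(s)=\max_{j\in H}u(s,j)$ and $R(s)=\max_{j\in Y}u(s,j)$. A mixed search $s$ is Pareto optimal if there is no mixed search $s'$ with $C(s')\le C(s)$ and $R(s')\le R(s)$, at least one inequality being strict. The Pareto frontier $P\subset\mathbb R^2$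 is the set of the pairs $(C(s),R(s))$ for the Pareto optimal $s$ with $R(s)<\infty$. Let $v_k=V_q(H)+\frac{(1-q)^k}{q}t(H^c)$ and $$\rho_k=t(Y)V_q(Y)+\frac{1-(1-q)^k}{(1-q)^k}\,t(H)V_q(H)+k\,t(H)t(H^c)\qquad(k=0,1,2,\dots).$$ Let $s_Z$ be the random ordering of the boxes of $Z$ whose first box is chosen with probability proportional to its search time and whose remaining boxes follow in uniformly random order. Let $s^k$ be the mixed search that draws an ordering of $H$ from $s_H$ and, independently, an ordering of $H^c$ from $s_{H^c}$, searches $H$ in the drawn order $k$ times, and then alternates forever between $H^c$ and $H$ (each in its drawn order, starting with $H^c$). For $0\le\beta\le1$ let $s^k(\beta)$ follow $s^k$ with probability $1-\beta$ and $s^{k+1}$ with probability $\beta$. Let $\beta^*=\frac1q-\frac{V_q(Y)-V_q(H)}{t(H^c)}$. Let $h^k(j)=\lambda_kt_j/(1-q)^k$ for $j\in H$ and $h^k(j)=\lambda_kt_j$ for $j\in H^c$, where $\lambda_k=\bigl(t(H)/(1-q)^k+t(H^c)\bigr)^{-1}$. **Theorem.** 1. For every nonempty $Z\subseteq Y$,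 $V_q(Z)$ is the value (minimax and maximin) of the game in which the Hider must hide in a box of $Z$. 2. The Pareto frontier is a union of line segments: $$P=\bigcup_{k\ge1}L_k\ \cup\ L_0,$$ $$L_k=\Bigl\{(c,r):\ \frac{t(H)}{(1-q)^k}\,c+t(H^c)\,r=\rho_k,\ \ v_{k+1}\le c\le v_k\Bigr\}\quad(k\ge1),$$ $$L_0=\bigl\{(c,r):\ t(H)\,c+t(H^c)\,r=t(Y)V_q(Y),\ \ v_1\le c\le V_q(Y)\bigr\}.$$ 3. The searches $s^k(\beta)$ with $k\ge1$, $0\le\beta\le1$ and $s^0(\beta)$ with $0\le\beta\le1$, $\beta\ge\beta^*$ are Pareto optimal with finite robustness, and $L_k=\{(C(s^k(\beta)),R(s^k(\beta))):0\le\beta\le1\}$ for $k\ge1$ and $L_0=\{(C(s^0(\beta)),R(s^0(\beta))):0\le\beta\le1,\ \beta\ge\beta^*\}$. 4. For every $k\ge0$, $h^k$ is a probability distribution on $Y$, the minimum of $u(S,h^k)$ over all pure searches $S$ exists and equals $\lambda_k\rho_k$, and every mixed search $s$ satisfies $$\frac{t(H)}{(1-q)^k}\,C(s)+t(H^c)\,R(s)\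 \ge\ \rho_k .$$ -/

import Mathlib

open MeasureTheory ProbabilityTheory
open scoped ENNReal

noncomputable section

/-- Data of box search with imperfect detection on the boxes `Fin n`: positive search times, and
the probability `q ∈ (0, 1)` that a look into the box containing the Hider finds the Hider. -/
structure BoxSearch (n : ℕ) where
  time : Fin n → ℝ
  time_pos : ∀ i, 0 < time i
  q : ℝ
  q_pos : 0 < q
  q_lt_one : q < 1

/-- A mixed search: a probability distribution with finite support on the infinite sequences of
boxes (the pure searches). -/
def MixedSearch (n : ℕ) : Type := {s : PMF (ℕ → Fin n) // s.support.Finite}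

namespace BoxSearch

variable {n : ℕ}

/-! ### The game -/

/-- The detection probability as an element of the unit interval. -/
def detectionProb (G : BoxSearch n) : unitInterval := ⟨G.q, G.q_pos.le, G.q_lt_one.le⟩

/-- The law of an infinite sequence of independent coins, each of which is `true` with
probability `q`. The coin `ω m` decides whether the `m`-th look is successful, provided that it is
a look into the box containing the Hider. -/
def coins (G : BoxSearch n) : Measure (ℕ → Bool) :=
  Measure.infinitePi fun _ : ℕ => bernoulliMeasure true false G.detectionProb

open Classical in
/-- The total time of the looks made by the pure search `S` up to and including the one that
finds the Hider in box `j`, when the coins show `ω`: the `m`-th look is made exactly if no earlier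
look has found the Hider. If the Hider is never found, this is the (infinite) sum of the times of
all looks. -/
def searchTime (G : BoxSearch n) (S : ℕ → Fin n) (j : Fin n) (ω : ℕ → Bool) : ℝ≥0∞ :=
  ∑' m : ℕ, if ∃ l < m, S l = j ∧ ω l = true then 0 else ENNReal.ofReal (G.time (S m))

/-- The expected search time `u(S, j)` of a pure search `S` against box `j`. -/
def payoffPure (G : BoxSearch n) (S : ℕ → Fin n) (j : Fin n) : ℝ≥0∞ :=
  ∫⁻ ω, G.searchTime S j ω ∂G.coins

/-- The expected search time `u(s, j)` of a mixed search `s` against box `j`. -/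
def payoff (G : BoxSearch n) (s : MixedSearch n) (j : Fin n) : ℝ≥0∞ :=
  ∑' S : ℕ → Fin n, s.1 S * G.payoffPure S j

/-- The expected search time `u(S, h)` of a pure search against a hiding distribution `h`. -/
def payoffHider (G : BoxSearch n) (S : ℕ → Fin n) (h : Fin n → ℝ) : ℝ≥0∞ :=
  ∑ j, ENNReal.ofReal (h j) * G.payoffPure S j

/-- `v` is the value of the game in which the Hider has to hide in one of the boxes of `Z`:
the minimax and the maximin expected search times are both equal to `v`. -/
def HasValue (G : BoxSearch n) (Z : Finset (Fin n)) (v : ℝ) : Prop :=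
  (⨅ s : MixedSearch n, ⨆ j ∈ Z, G.payoff s j) = ENNReal.ofReal v ∧
  (⨆ h ∈ {h : Fin n → ℝ | h ∈ stdSimplex ℝ (Fin n) ∧ ∀ j ∉ Z, h j = 0},
    ⨅ S : ℕ → Fin n, G.payoffHider S h) = ENNReal.ofReal v

/-! ### Consistency, robustness and the Pareto frontier for a prediction `H` -/

/-- The consistency `C(s)` of `s` for the prediction `H`. -/
def consistency (G : BoxSearch n) (H : Finset (Fin n)) (s : MixedSearch n) : ℝ≥0∞ :=
  ⨆ j ∈ H, G.payoff s j

/-- The robustness `R(s)` of `s`. -/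
def robustness (G : BoxSearch n) (s : MixedSearch n) : ℝ≥0∞ :=
  ⨆ j, G.payoff s j

/-- `s` is Pareto optimal: no mixed search is at least as good in both objectives and strictly
better in one of them. -/
def ParetoOptimal (G : BoxSearch n) (H : Finset (Fin n)) (s : MixedSearch n) : Prop :=
  ¬ ∃ s' : MixedSearch n, G.consistency H s' ≤ G.consistency H s ∧
    G.robustness s' ≤ G.robustness s ∧
    (G.consistency H s' < G.consistency H s ∨ G.robustness s' < G.robustness s)

/-- The pair `(C(s), R(s))` as a pair of real numbers (meaningful if `R(s)` is finite, which
forces `C(s)` to be finite). -/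
def point (G : BoxSearch n) (H : Finset (Fin n)) (s : MixedSearch n) : ℝ × ℝ :=
  ((G.consistency H s).toReal, (G.robustness s).toReal)

/-- The Pareto frontier: the pairs `(C(s), R(s))` of real numbers for `s` Pareto optimal. -/
def paretoFrontier (G : BoxSearch n) (H : Finset (Fin n)) : Set (ℝ × ℝ) :=
  {p | ∃ s : MixedSearch n, G.ParetoOptimal H s ∧ G.robustness s ≠ ∞ ∧ p = G.point H s}

/-! ### The quantities occurring in the description of the frontier -/

/-- `t(Z)`, the total search time of the boxes in `Z`. -/
def t (G : BoxSearch n) (Z : Finset (Fin n)) : ℝ := ∑ i ∈ Z, G.time i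

/-- `V_q(Z) = t(Z) / q - (∑_{i < j} t_i t_j) / t(Z)`, with `i, j` ranging over `Z`. -/
def V (G : BoxSearch n) (Z : Finset (Fin n)) : ℝ :=
  G.t Z / G.q - (∑ i ∈ Z, ∑ j ∈ Z with i < j, G.time i * G.time j) / G.t Z

/-- `v_k = V_q(H) + ((1-q)^k / q) t(Hᶜ)`. -/
def v (G : BoxSearch n) (H : Finset (Fin n)) (k : ℕ) : ℝ :=
  G.V H + (1 - G.q) ^ k / G.q * G.t Hᶜ

/-- The right-hand side of the equation of the `k`-th line. -/
def rhs (G : BoxSearch n) (H : Finset (Fin n)) (k : ℕ) : ℝ :=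
  G.t Finset.univ * G.V Finset.univ + (1 - (1 - G.q) ^ k) / (1 - G.q) ^ k * (G.t H * G.V H)
    + k * (G.t H * G.t Hᶜ)

/-- The segment with index `k ≥ 1`. -/
def kthSegment (G : BoxSearch n) (H : Finset (Fin n)) (k : ℕ) : Set (ℝ × ℝ) :=
  {p | G.t H / (1 - G.q) ^ k * p.1 + G.t Hᶜ * p.2 = G.rhs H k ∧
    G.v H (k + 1) ≤ p.1 ∧ p.1 ≤ G.v H k}

/-- The first segment. -/
def firstSegment (G : BoxSearch n) (H : Finset (Fin n)) : Set (ℝ × ℝ) :=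
  {p | G.t H * p.1 + G.t Hᶜ * p.2 = G.t Finset.univ * G.V Finset.univ ∧
    G.v H 1 ≤ p.1 ∧ p.1 ≤ G.V Finset.univ}

/-- `β* = 1/q - (V_q(Y) - V_q(H)) / t(Hᶜ)`. -/
def betaStar (G : BoxSearch n) (H : Finset (Fin n)) : ℝ :=
  1 / G.q - (G.V Finset.univ - G.V H) / G.t Hᶜ

/-! ### The hiding distributions `h^k` -/

/-- The normalizing factor `λ_k`. -/
def lam (G : BoxSearch n) (H : Finset (Fin n)) (k : ℕ) : ℝ :=
  (G.t H / (1 - G.q) ^ k + G.t Hᶜ)⁻¹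

/-- `h^k(j)` is `λ_k t_j / (1-q)^k` for `j ∈ H` and `λ_k t_j` for `j ∉ H`. -/
def hider (G : BoxSearch n) (H : Finset (Fin n)) (k : ℕ) (j : Fin n) : ℝ :=
  if j ∈ H then G.lam H k * G.time j / (1 - G.q) ^ k else G.lam H k * G.time j

/-! ### The searches `s^k(β)` -/

/-- A box of `Z` drawn with probability proportional to its search time. -/
def firstBox (G : BoxSearch n) (Z : Finset (Fin n)) (hZ : Z.Nonempty) : PMF (Fin n) :=
  PMF.normalize (fun j => if j ∈ Z then ENNReal.ofReal (G.time j) else 0)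
    (by
      obtain ⟨j, hj⟩ := hZ
      intro h
      have := ENNReal.tsum_eq_zero.1 h j
      simp only [hj, if_true, ENNReal.ofReal_eq_zero] at this
      exact absurd (G.time_pos j) (not_lt.2 this))
    (by
      rw [tsum_fintype]
      refine ENNReal.sum_ne_top.2 fun j _ => ?_
      split_ifs <;> simp)

/-- A uniformly random ordering of the boxes of `Z`. -/
def uniformOrder (Z : Finset (Fin n)) : PMF (List (Fin n)) :=
  PMF.uniformOfFinset ⟨Multiset.lists Z.val, Multiset.lists_nodup_finset Z⟩
    (show Finset.Nonempty _ from ⟨Z.toList, by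
      rw [Finset.mem_mk, Multiset.mem_lists_iff]
      exact (Finset.coe_toList Z).symm⟩)

/-- The random ordering `s_Z` of the boxes of `Z`: the first box is drawn with probability
proportional to its search time, and the others follow in a uniformly random order. -/
def order (G : BoxSearch n) (Z : Finset (Fin n)) (hZ : Z.Nonempty) :
    PMF {l : List (Fin n) // l ≠ []} :=
  (G.firstBox Z hZ).bind fun j =>
    (uniformOrder (Z.erase j)).map fun l => ⟨j :: l, List.cons_ne_nil j l⟩

/-- The pure search that follows `x` for `k` times and then repeats `y, x` forever. -/
def alternate (k : ℕ) (x y : {l : List (Fin n) // l ≠ []}) : ℕ → Fin n :=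
  ((List.replicate k x.1).flatten ++ₛ
    Stream'.cycle (y.1 ++ x.1) (List.append_ne_nil_of_right_ne_nil y.1 x.2)).get

theorem order_support_finite (G : BoxSearch n) (Z : Finset (Fin n)) (hZ : Z.Nonempty) :
    (G.order Z hZ).support.Finite := by
  rw [order, PMF.support_bind]
  refine Set.Finite.biUnion (Set.toFinite _) fun j _ => ?_
  rw [PMF.support_map, uniformOrder, PMF.support_uniformOfFinset]
  exact (Finset.finite_toSet _).image _

/-- The search `s^k`: with an ordering of `H` drawn from `s_H` and, independently, an ordering of
`Hᶜ` drawn from `s_{Hᶜ}`, go through `H` for `k` times, and then alternate between `Hᶜ` and `H`. -/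
def sk (G : BoxSearch n) (H : Finset (Fin n)) (hH : H.Nonempty) (hHc : Hᶜ.Nonempty) (k : ℕ) :
    MixedSearch n :=
  ⟨(G.order H hH).bind fun x => (G.order Hᶜ hHc).map fun y => alternate k x y, by
    rw [PMF.support_bind]
    refine Set.Finite.biUnion (G.order_support_finite H hH) fun x _ => ?_
    rw [PMF.support_map]
    exact (G.order_support_finite Hᶜ hHc).image _⟩

/-- The mixture that draws from `p` with probability `1 - β` and from `p'` with probability `β`. -/
def mixPMF {α : Type*} (β : unitInterval) (p p' : PMF α) : PMF α :=
  ⟨fun x => ENNReal.ofReal (1 - β) * p x + ENNReal.ofReal β * p' x, by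
    have h := (ENNReal.summable (f := fun x =>
      ENNReal.ofReal (1 - β) * p x + ENNReal.ofReal β * p' x)).hasSum
    rwa [ENNReal.tsum_add, ENNReal.tsum_mul_left, ENNReal.tsum_mul_left, p.tsum_coe,
      p'.tsum_coe, mul_one, mul_one,
      ← ENNReal.ofReal_add (sub_nonneg.2 β.2.2) β.2.1, sub_add_cancel, ENNReal.ofReal_one] at h⟩

/-- The mixed search that follows `s` with probability `1 - β` and `s'` with probability `β`. -/
def mix (β : unitInterval) (s s' : MixedSearch n) : MixedSearch n :=
  ⟨mixPMF β s.1 s'.1, by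
    refine (s.2.union s'.2).subset fun S hS => ?_
    by_contra hc
    have h1 : s.1 S = 0 := by
      by_contra h
      exact hc (Or.inl h)
    have h2 : s'.1 S = 0 := by
      by_contra h
      exact hc (Or.inr h)
    refine hS ?_
    change ENNReal.ofReal (1 - β) * s.1 S + ENNReal.ofReal β * s'.1 S = 0
    rw [h1, h2, mul_zero, mul_zero, add_zero]⟩

/-- The search `s^k(β)`, which follows `s^k` with probability `1 - β` and `s^{k+1}` with
probability `β`. -/
def skMix (G : BoxSearch n) (H : Finset (Fin n)) (hH : H.Nonempty) (hHc : Hᶜ.Nonempty) (k : ℕ)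
    (β : unitInterval) : MixedSearch n :=
  mix β (G.sk H hH hHc k) (G.sk H hH hHc (k + 1))

end BoxSearch

end

/-!
A look into box `i` after `c` earlier looks into box `j` is made with probability `(1-q)^c` if the
Hider is in `j` (`payoffPure_eq_tsum`). So against hiding weights proportional to
`t_j (1-q)^(b j)` a look into `i` costs `t_i ∑_j t_j (1-q)^(b j + c j)`, where `c j` counts the
earlier looks into `j`, and the cost splits into contributions of pairs of boxes. For each pair the
cheapest continuation first levels the two exponents and then alternates; its cost is explicit
(`pairPotential`). Summing over pairs gives a potential that no look decreases by more than its
cost (`potential_le`) and that tends to zero if all boxes are searched infinitely often (otherwise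
the payoff is infinite). Hence the initial potential is a lower bound for the cost of every search
(`potential_le_payoff`). With `b = 0` on `Z` it is `t(Z) V_q(Z)`; with `b = 0` on `H` and `b = k`
off `H` it is `(1-q)^k ρ_k` (`potential_shift`), which gives the linear inequalities between
consistency and robustness (`rhs_le`).

Conversely, the payoffs of the searches built from random orderings are computed exactly. An
ordering and its reversal show that in a uniformly random order each other box precedes a given box
with probability one half; drawing the first box proportionally to its search time then makes the
expected arrival times of all boxes equal (`expect_arrival_order`). Repeating `s_Z` forever
therefore achieves `V_q(Z)` against every box of `Z`, and `s^k` has payoff `v_k` on `H` and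
`outer H k` off `H`, both on the `k`-th line; since raising `k` by one moves along that line, so do
the mixtures `s^k(β)`. For `k ≥ 1`, or `β ≥ β*`, the payoff off `H` is the larger one, so these
searches are Pareto optimal because they attain a linear bound with positive coefficients.

For the frontier, finite robustness forces `C(s) > V_q(H)`, because the bounds `ρ_k` contain the
term `k t(H) t(Hᶜ)` (`V_lt_consistency`). As `v_k` decreases to `V_q(H)`, every such search is
weakly dominated by some `s^k(β)` (`exists_skMix_le`), so a Pareto optimal one has the same
consistency and robustness.
-/

namespace BoxSearch

variable {n : ℕ}

theorem r_pos (G : BoxSearch n) : 0 < 1 - G.q := sub_pos.2 G.q_lt_one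

theorem r_lt_one (G : BoxSearch n) : 1 - G.q < 1 := sub_lt_self _ G.q_pos

/-! ### The payoff of a pure search as a series -/

theorem coins_all_false (G : BoxSearch n) (s : Finset ℕ) :
    G.coins {ω | ∀ l ∈ s, ω l = false} = ENNReal.ofReal ((1 - G.q) ^ s.card) := by
  have h : {ω : ℕ → Bool | ∀ l ∈ s, ω l = false} = Set.pi s fun _ => {false} := by
    ext ω
    simp [Set.mem_pi]
  have hb : bernoulliMeasure true false G.detectionProb {false} = ENNReal.ofReal (1 - G.q) := by
    rw [bernoulliMeasure_apply_of_notMem_of_mem _ (MeasurableSet.singleton _) (by simp) (by simp),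
      ENNReal.ofReal, ENNReal.coe_inj]
    ext
    simp [detectionProb, Real.coe_toNNReal _ G.r_pos.le]
  rw [h, coins, Measure.infinitePi_pi]
  · simp only [hb, Finset.prod_const]
    rw [ENNReal.ofReal_pow G.r_pos.le]
  · intro i _
    exact MeasurableSet.singleton _

/-- The `m`-th look is made with probability `(1 - q) ^ c`, where `c` is the number of earlier
looks into the box containing the Hider. -/
theorem payoffPure_eq_tsum (G : BoxSearch n) (S : ℕ → Fin n) (j : Fin n) :
    G.payoffPure S j = ∑' m : ℕ,
      ENNReal.ofReal (G.time (S m) * (1 - G.q) ^ Nat.count (fun l => S l = j) m) := by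
  classical
  have hset : ∀ m : ℕ, {ω : ℕ → Bool | ∃ l < m, S l = j ∧ ω l = true}ᶜ =
      {ω | ∀ l ∈ (Finset.range m).filter (fun l => S l = j), ω l = false} := by
    intro m
    ext ω
    simp
  have hmeas : ∀ m : ℕ, MeasurableSet {ω : ℕ → Bool | ∃ l < m, S l = j ∧ ω l = true} := by
    intro m
    rw [← MeasurableSet.compl_iff, hset]
    simp only [Set.ofPred_forall]
    refine MeasurableSet.iInter fun l => MeasurableSet.iInter fun _ => ?_
    exact (measurable_pi_apply (X := fun _ : ℕ => Bool) l) (MeasurableSet.singleton false)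
  have hind : ∀ m (ω : ℕ → Bool), (if ∃ l < m, S l = j ∧ ω l = true then 0
      else ENNReal.ofReal (G.time (S m))) =
      ({ω : ℕ → Bool | ∃ l < m, S l = j ∧ ω l = true}ᶜ).indicator
        (fun _ => ENNReal.ofReal (G.time (S m))) ω := by
    intro m ω
    by_cases h : ∃ l < m, S l = j ∧ ω l = true
    · rw [if_pos h, Set.indicator_of_notMem]
      exact fun h' => h' h
    · rw [if_neg h, Set.indicator_of_mem]
      exact h
  unfold payoffPure searchTime
  rw [lintegral_tsum]
  · refine tsum_congr fun m => ?_
    rw [lintegral_congr fun ω => ?_, lintegral_indicator_const (hmeas m).compl, hset m,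
      coins_all_false, ← ENNReal.ofReal_mul (G.time_pos _).le, Nat.count_eq_card_filter_range]
    convert hind m ω
  · intro m
    refine (Measurable.ite ?_ measurable_const measurable_const).aemeasurable
    exact hmeas m

/-- The payoff splits at the `L`-th look. -/
theorem payoffPure_split (G : BoxSearch n) (S : ℕ → Fin n) (j : Fin n) (L : ℕ) :
    G.payoffPure S j = (∑ m ∈ Finset.range L,
      ENNReal.ofReal (G.time (S m) * (1 - G.q) ^ Nat.count (fun l => S l = j) m)) +
      ENNReal.ofReal ((1 - G.q) ^ Nat.count (fun l => S l = j) L) *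
        G.payoffPure (fun m => S (m + L)) j := by
  rw [payoffPure_eq_tsum, payoffPure_eq_tsum,
    ← Summable.sum_add_tsum_nat_add' (k := L) ENNReal.summable, ← ENNReal.tsum_mul_left]
  congr 1
  refine tsum_congr fun m => ?_
  rw [← ENNReal.ofReal_mul (pow_nonneg G.r_pos.le _), add_comm m L, Nat.count_add, pow_add]
  congr 1
  simp only [add_comm L]
  ring

/-- A search that looks into a box only finitely often has infinite payoff against it. -/
theorem payoffPure_eq_top (G : BoxSearch n) (S : ℕ → Fin n) (j : Fin n)
    (h : ¬ Filter.Tendsto (fun m => Nat.count (fun l => S l = j) m) Filter.atTop Filter.atTop) :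
    G.payoffPure S j = ∞ := by
  obtain ⟨b, hb⟩ : ∃ b, ∀ m, Nat.count (fun l => S l = j) m ≤ b := by
    by_contra! hc
    exact h (Filter.tendsto_atTop_atTop_of_monotone (Nat.count_monotone _)
      fun b => (hc b).imp fun _ => le_of_lt)
  -- If there are at most `b` looks into `j`, every look costs at least `t_i (1 - q) ^ b`, where
  -- `t_i` is the shortest search time.
  obtain ⟨i, -, hi⟩ := Finset.exists_min_image Finset.univ G.time ⟨j, Finset.mem_univ j⟩
  rw [payoffPure_eq_tsum, ← top_le_iff]
  have hc : ENNReal.ofReal (G.time i * (1 - G.q) ^ b) ≠ 0 := by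
    rw [Ne, ENNReal.ofReal_eq_zero, not_le]
    exact mul_pos (G.time_pos i) (pow_pos G.r_pos b)
  rw [← ENNReal.tsum_const_eq_top_of_ne_zero (α := ℕ) hc]
  refine ENNReal.tsum_le_tsum fun m => ENNReal.ofReal_le_ofReal ?_
  exact mul_le_mul (hi _ (Finset.mem_univ _))
    (pow_le_pow_of_le_one G.r_pos.le G.r_lt_one.le (hb m)) (pow_nonneg G.r_pos.le _)
    (G.time_pos _).le

/-! ### The potential and the lower bound for hiding distributions -/

/-- The pair potential: up to the factor `t_i t_j`, the least cost that two boxes `i` and `j`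
inflict on each other when their residual weights are `t_i (1-q)^a` and `t_j (1-q)^b`. A look into
`i` costs `(1-q)^b` and increases `a` by one, and symmetrically; the optimal continuation first
levels the exponents and then alternates. -/
noncomputable def pairPotential (G : BoxSearch n) (a b : ℕ) : ℝ :=
  (1 - G.q) ^ max a b * (|(a : ℝ) - b| + (2 / G.q - 1))

theorem pairPotential_comm (G : BoxSearch n) (a b : ℕ) :
    G.pairPotential a b = G.pairPotential b a := by
  rw [pairPotential, pairPotential, max_comm, abs_sub_comm]

theorem pairPotential_self (G : BoxSearch n) (a : ℕ) :
    G.pairPotential a a = (1 - G.q) ^ a * (2 / G.q - 1) := by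
  simp [pairPotential]

theorem pairPotential_nonneg (G : BoxSearch n) (a b : ℕ) : 0 ≤ G.pairPotential a b := by
  have h : 1 ≤ 1 / G.q := by rw [le_div_iff₀ G.q_pos]; linarith [G.q_lt_one]
  have h2 : 2 / G.q = 2 * (1 / G.q) := by ring
  refine mul_nonneg (pow_nonneg G.r_pos.le _) (add_nonneg (abs_nonneg _) ?_)
  linarith

theorem pow_mul_one_add_le_one (G : BoxSearch n) (d : ℕ) :
    (1 - G.q) ^ d * (1 + d * G.q) ≤ 1 := by
  have h := one_add_mul_le_pow (a := G.q) (by linarith [G.q_pos]) d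
  calc (1 - G.q) ^ d * (1 + d * G.q) ≤ (1 - G.q) ^ d * (1 + G.q) ^ d :=
        mul_le_mul_of_nonneg_left h (pow_nonneg G.r_pos.le d)
    _ = (1 - G.q ^ 2) ^ d := by rw [← mul_pow]; ring
    _ ≤ 1 := pow_le_one₀ (by nlinarith [G.q_pos, G.q_lt_one]) (by nlinarith [G.q_pos])

/-- A look into the first box lowers the pair potential by at most the cost of the look. -/
theorem pairPotential_le (G : BoxSearch n) (a b : ℕ) :
    G.pairPotential a b ≤ (1 - G.q) ^ b + G.pairPotential (a + 1) b := by
  have hq := G.q_pos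
  unfold pairPotential
  rcases lt_or_ge a b with h | h
  · obtain ⟨d, rfl⟩ := Nat.exists_eq_add_of_lt h
    rw [max_eq_right (by omega), max_eq_right (by omega)]
    push_cast
    rw [abs_of_nonpos (by linarith [(Nat.cast_nonneg d : (0 : ℝ) ≤ d)]),
      abs_of_nonpos (by linarith [(Nat.cast_nonneg d : (0 : ℝ) ≤ d)])]
    apply le_of_eq
    ring
  · obtain ⟨d, rfl⟩ := Nat.exists_eq_add_of_le h
    rw [max_eq_left (by omega), max_eq_left (by omega)]
    push_cast
    rw [abs_of_nonneg (by linarith [(Nat.cast_nonneg d : (0 : ℝ) ≤ d)]),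
      abs_of_nonneg (by linarith [(Nat.cast_nonneg d : (0 : ℝ) ≤ d)])]
    have h1 := mul_le_mul_of_nonneg_left (G.pow_mul_one_add_le_one d) (pow_nonneg G.r_pos.le b)
    have h2 : (1 - G.q) ^ (b + d) * ((b : ℝ) + d - b + (2 / G.q - 1)) -
        (1 - G.q) ^ (b + d + 1) * ((b : ℝ) + d + 1 - b + (2 / G.q - 1)) =
        (1 - G.q) ^ b * ((1 - G.q) ^ d * (1 + d * G.q)) := by
      field_simp
      ring
    linarith

/-- The potential of the boxes of `Z` with residual weights `t_j (1-q)^(c j)`: a lower bound for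
the remaining cost. -/
noncomputable def potential (G : BoxSearch n) (Z : Finset (Fin n)) (c : Fin n → ℕ) : ℝ :=
  ((∑ i ∈ Z, G.time i ^ 2 * (1 - G.q) ^ c i) +
    ∑ i ∈ Z, ∑ j ∈ Z, G.time i * G.time j * G.pairPotential (c i) (c j)) / 2

/-- A look into any box `i` lowers the potential by at most the cost of the look. -/
theorem potential_le (G : BoxSearch n) (Z : Finset (Fin n)) (c c' : Fin n → ℕ) (i : Fin n)
    (hc : ∀ j, c' j = c j + if i = j then 1 else 0) :
    G.potential Z c ≤ G.time i * ∑ j ∈ Z, G.time j * (1 - G.q) ^ c j + G.potential Z c' := by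
  classical
  have hq := G.q_pos
  have hterm : ∀ a ∈ Z, ∀ b ∈ Z,
      (if a = b then G.time a ^ 2 * (1 - G.q) ^ c a else 0) +
        G.time a * G.time b * G.pairPotential (c a) (c b) ≤
      ((if a = i then G.time i * (G.time b * (1 - G.q) ^ c b) else 0) +
        (if b = i then G.time i * (G.time a * (1 - G.q) ^ c a) else 0)) +
      ((if a = b then G.time a ^ 2 * (1 - G.q) ^ c' a else 0) +
        G.time a * G.time b * G.pairPotential (c' a) (c' b)) := by
    intro a _ b _
    have hab : 0 ≤ G.time a * G.time b := (mul_pos (G.time_pos a) (G.time_pos b)).le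
    by_cases ha : a = i <;> by_cases hb : b = i
    · subst ha; subst hb
      simp only [hc, if_true, pairPotential_self]
      apply le_of_eq
      field_simp
      ring
    · subst ha
      have h := mul_le_mul_of_nonneg_left (G.pairPotential_le (c a) (c b)) hab
      simp only [hc, if_true, hb, Ne.symm hb, if_false, add_zero]
      linarith
    · subst hb
      have h := mul_le_mul_of_nonneg_left (G.pairPotential_le (c b) (c a)) hab
      simp only [hc, if_true, ha, Ne.symm ha, if_false, add_zero]
      rw [G.pairPotential_comm (c a) (c b + 1), G.pairPotential_comm (c a) (c b)]
      linarith
    · simp [hc, ha, hb, Ne.symm ha, Ne.symm hb]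
  have hsum := Finset.sum_le_sum fun a ha => Finset.sum_le_sum (hterm a ha)
  have hdiag : ∀ d : Fin n → ℕ, (∑ a ∈ Z, ∑ b ∈ Z,
      ((if a = b then G.time a ^ 2 * (1 - G.q) ^ d a else 0) +
        G.time a * G.time b * G.pairPotential (d a) (d b))) = 2 * G.potential Z d := by
    intro d
    simp only [Finset.sum_add_distrib, Finset.sum_ite_eq, potential]
    rw [Finset.sum_congr rfl fun a ha => if_pos ha]
    ring
  have hcost : (∑ a ∈ Z, ∑ b ∈ Z,
      ((if a = i then G.time i * (G.time b * (1 - G.q) ^ c b) else 0) +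
        (if b = i then G.time i * (G.time a * (1 - G.q) ^ c a) else 0))) ≤
      2 * (G.time i * ∑ j ∈ Z, G.time j * (1 - G.q) ^ c j) := by
    have h0 : 0 ≤ G.time i * ∑ j ∈ Z, G.time j * (1 - G.q) ^ c j :=
      mul_nonneg (G.time_pos i).le (Finset.sum_nonneg fun j _ =>
        mul_nonneg (G.time_pos j).le (pow_nonneg G.r_pos.le _))
    simp only [Finset.sum_add_distrib]
    rw [Finset.sum_comm]
    simp only [Finset.sum_ite_eq']
    by_cases hi : i ∈ Z
    · simp only [hi, if_true, ← Finset.mul_sum]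
      linarith
    · simp only [hi, if_false, Finset.sum_const_zero]
      linarith
  rw [hdiag] at hsum
  rw [Finset.sum_congr rfl fun a _ => Finset.sum_add_distrib, Finset.sum_add_distrib, hdiag]
    at hsum
  linarith

theorem tendsto_pairPotential (G : BoxSearch n) {f g : ℕ → ℕ}
    (hf : Filter.Tendsto f Filter.atTop Filter.atTop) :
    Filter.Tendsto (fun m => G.pairPotential (f m) (g m)) Filter.atTop (nhds 0) := by
  have h1 : Filter.Tendsto (fun d : ℕ => (1 - G.q) ^ d * ((d : ℝ) + (2 / G.q - 1)))
      Filter.atTop (nhds 0) := by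
    have ha := tendsto_self_mul_const_pow_of_lt_one G.r_pos.le G.r_lt_one
    have hb := (tendsto_pow_atTop_nhds_zero_of_lt_one G.r_pos.le G.r_lt_one).mul_const
      (2 / G.q - 1)
    rw [zero_mul] at hb
    have := ha.add hb
    rw [add_zero] at this
    refine this.congr fun d => ?_
    ring
  have hmax : Filter.Tendsto (fun m => max (f m) (g m)) Filter.atTop Filter.atTop :=
    Filter.tendsto_atTop_mono (fun m => le_max_left _ _) hf
  refine squeeze_zero (fun m => G.pairPotential_nonneg _ _) (fun m => ?_) (h1.comp hmax)
  refine mul_le_mul_of_nonneg_left ?_ (pow_nonneg G.r_pos.le _)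
  have hx : (0 : ℝ) ≤ f m := Nat.cast_nonneg _
  have hy : (0 : ℝ) ≤ g m := Nat.cast_nonneg _
  have : |(f m : ℝ) - g m| ≤ ((max (f m) (g m) : ℕ) : ℝ) := by
    push_cast
    rw [abs_le]
    constructor
    · linarith [le_max_right (f m : ℝ) (g m)]
    · linarith [le_max_left (f m : ℝ) (g m)]
  linarith

theorem tendsto_potential (G : BoxSearch n) (Z : Finset (Fin n)) {c : ℕ → Fin n → ℕ}
    (hc : ∀ j ∈ Z, Filter.Tendsto (fun m => c m j) Filter.atTop Filter.atTop) :
    Filter.Tendsto (fun m => G.potential Z (c m)) Filter.atTop (nhds 0) := by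
  have h1 : Filter.Tendsto (fun m => ∑ i ∈ Z, G.time i ^ 2 * (1 - G.q) ^ c m i)
      Filter.atTop (nhds (∑ i ∈ Z, G.time i ^ 2 * 0)) :=
    tendsto_finsetSum _ fun i hi => Filter.Tendsto.const_mul _
      ((tendsto_pow_atTop_nhds_zero_of_lt_one G.r_pos.le G.r_lt_one).comp (hc i hi))
  have h2 : Filter.Tendsto (fun m => ∑ i ∈ Z, ∑ j ∈ Z,
      G.time i * G.time j * G.pairPotential (c m i) (c m j))
      Filter.atTop (nhds (∑ i ∈ Z, ∑ j ∈ Z, G.time i * G.time j * 0)) :=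
    tendsto_finsetSum _ fun i hi => tendsto_finsetSum _ fun j _ => Filter.Tendsto.const_mul _
      (G.tendsto_pairPotential (hc i hi))
  have := (h1.add h2).div_const 2
  simpa [potential] using this

/-- The potential bounds from below the cost of a pure search against the (unnormalized) hiding
weights `t_j (1-q)^(b j)` on `Z`. -/
theorem potential_le_payoff (G : BoxSearch n) (Z : Finset (Fin n)) (b : Fin n → ℕ)
    (S : ℕ → Fin n) :
    ENNReal.ofReal (G.potential Z b) ≤
      ∑ j ∈ Z, ENNReal.ofReal (G.time j * (1 - G.q) ^ b j) * G.payoffPure S j := by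
  have hw : ∀ j, 0 < G.time j * (1 - G.q) ^ b j := fun j =>
    mul_pos (G.time_pos j) (pow_pos G.r_pos _)
  by_cases hS : ∀ j ∈ Z, Filter.Tendsto (fun m => Nat.count (fun l => S l = j) m)
      Filter.atTop Filter.atTop
  swap
  · push Not at hS
    obtain ⟨j, hj, h⟩ := hS
    rw [ENNReal.sum_eq_top.2 ⟨j, hj, ?_⟩]
    · exact le_top
    · rw [G.payoffPure_eq_top S j h, ENNReal.mul_top]
      exact (ENNReal.ofReal_pos.2 (hw j)).ne'
  set c : ℕ → Fin n → ℕ := fun m j => b j + Nat.count (fun l => S l = j) m with hcdef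
  have hstep : ∀ m, G.potential Z b ≤ (∑ l ∈ Finset.range m,
      G.time (S l) * ∑ j ∈ Z, G.time j * (1 - G.q) ^ c l j) + G.potential Z (c m) := by
    intro m
    induction m with
    | zero => simp [hcdef]
    | succ m ih =>
      rw [Finset.sum_range_succ]
      have := G.potential_le Z (c m) (c (m + 1)) (S m) fun j => by
        simp only [hcdef, Nat.count_succ, add_assoc]
      linarith
  have hpart : ∀ m, ENNReal.ofReal (∑ l ∈ Finset.range m,
      G.time (S l) * ∑ j ∈ Z, G.time j * (1 - G.q) ^ c l j) ≤
      ∑ j ∈ Z, ENNReal.ofReal (G.time j * (1 - G.q) ^ b j) * G.payoffPure S j := by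
    intro m
    have h : (∑ l ∈ Finset.range m, G.time (S l) * ∑ j ∈ Z, G.time j * (1 - G.q) ^ c l j) =
        ∑ j ∈ Z, G.time j * (1 - G.q) ^ b j * ∑ l ∈ Finset.range m,
          G.time (S l) * (1 - G.q) ^ Nat.count (fun l => S l = j) l := by
      simp only [Finset.mul_sum]
      rw [Finset.sum_comm]
      refine Finset.sum_congr rfl fun j _ => Finset.sum_congr rfl fun l _ => ?_
      simp only [hcdef, pow_add]
      ring
    have hnn : ∀ j l, 0 ≤ G.time (S l) * (1 - G.q) ^ Nat.count (fun l => S l = j) l := fun j l =>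
      mul_nonneg (G.time_pos _).le (pow_nonneg G.r_pos.le _)
    rw [h, ENNReal.ofReal_sum_of_nonneg fun j _ =>
      mul_nonneg (hw j).le (Finset.sum_nonneg fun l _ => hnn j l)]
    refine Finset.sum_le_sum fun j _ => ?_
    rw [ENNReal.ofReal_mul (hw j).le, payoffPure_eq_tsum,
      ENNReal.ofReal_sum_of_nonneg fun l _ => hnn j l]
    exact mul_le_mul_right (ENNReal.sum_le_tsum _) _
  have hlim : Filter.Tendsto (fun m => ENNReal.ofReal (G.potential Z b - G.potential Z (c m)))
      Filter.atTop (nhds (ENNReal.ofReal (G.potential Z b))) := by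
    refine ENNReal.tendsto_ofReal ?_
    have := (tendsto_const_nhds (x := G.potential Z b)).sub (G.tendsto_potential Z (c := c)
      fun j hj => Filter.tendsto_atTop_mono (fun m => Nat.le_add_left _ _) (hS j hj))
    rwa [sub_zero] at this
  refine le_of_tendsto' hlim fun m => le_trans (ENNReal.ofReal_le_ofReal ?_) (hpart m)
  linarith [hstep m]

/-! ### Payoffs of searches built from finite words -/

/-- The expected time spent on the finite sequence of looks `l` when the Hider is in box `j`. -/
noncomputable def wordCost (G : BoxSearch n) (j : Fin n) : List (Fin n) → ℝ
  | [] => 0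
  | a :: l => G.time a + (if a = j then 1 - G.q else 1) * wordCost G j l

/-- The total time of the finite sequence of looks `l`. -/
noncomputable def wordTime (G : BoxSearch n) (l : List (Fin n)) : ℝ := (l.map G.time).sum

/-- The total time of the looks in `l` up to and including the first one into box `j`. -/
noncomputable def arrival (G : BoxSearch n) (j : Fin n) : List (Fin n) → ℝ
  | [] => 0
  | a :: l => G.time a + if a = j then 0 else arrival G j l

theorem wordCost_nonneg (G : BoxSearch n) (j : Fin n) (l : List (Fin n)) :
    0 ≤ G.wordCost j l := by
  induction l with
  | nil => exact le_rfl
  | cons a l ih =>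
    refine add_nonneg (G.time_pos a).le (mul_nonneg ?_ ih)
    split_ifs
    exacts [G.r_pos.le, zero_le_one]

theorem arrival_nonneg (G : BoxSearch n) (j : Fin n) (l : List (Fin n)) :
    0 ≤ G.arrival j l := by
  induction l with
  | nil => exact le_rfl
  | cons a l ih =>
    refine add_nonneg (G.time_pos a).le ?_
    split_ifs
    exacts [le_rfl, ih]

theorem wordTime_append (G : BoxSearch n) (l l' : List (Fin n)) :
    G.wordTime (l ++ l') = G.wordTime l + G.wordTime l' := by
  simp [wordTime]

theorem wordTime_cons (G : BoxSearch n) (a : Fin n) (l : List (Fin n)) :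
    G.wordTime (a :: l) = G.time a + G.wordTime l := by
  simp [wordTime]

theorem wordCost_append (G : BoxSearch n) (j : Fin n) (l l' : List (Fin n)) :
    G.wordCost j (l ++ l') = G.wordCost j l + (1 - G.q) ^ l.count j * G.wordCost j l' := by
  induction l with
  | nil => simp [wordCost]
  | cons a l ih =>
    rw [List.cons_append, wordCost, wordCost, ih, List.count_cons]
    by_cases h : a = j
    · simp only [h, if_true, beq_self_eq_true, pow_succ]
      ring
    · simp only [h, if_false, beq_eq_false_iff_ne.2 h, Bool.false_eq_true, add_zero]
      ring

theorem wordCost_of_notMem (G : BoxSearch n) {j : Fin n} {l : List (Fin n)} (h : j ∉ l) :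
    G.wordCost j l = G.wordTime l := by
  induction l with
  | nil => simp [wordCost, wordTime]
  | cons a l ih =>
    rw [List.mem_cons, not_or] at h
    rw [wordCost, if_neg (Ne.symm h.1), ih h.2, one_mul, wordTime_cons]

theorem arrival_split (G : BoxSearch n) {j : Fin n} {l l' : List (Fin n)} (h : j ∉ l) :
    G.arrival j (l ++ j :: l') = G.wordTime l + G.time j := by
  induction l with
  | nil => simp [arrival, wordTime]
  | cons a l ih =>
    rw [List.mem_cons, not_or] at h
    rw [List.cons_append, arrival, if_neg (Ne.symm h.1), ih h.2, wordTime_cons, add_assoc]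

theorem exists_split {j : Fin n} {l : List (Fin n)} (hl : l.Nodup) (hj : j ∈ l) :
    ∃ l₁ l₂, l = l₁ ++ j :: l₂ ∧ j ∉ l₁ ∧ j ∉ l₂ := by
  obtain ⟨l₁, l₂, rfl⟩ := List.append_of_mem hj
  refine ⟨l₁, l₂, rfl, ?_, ?_⟩
  · intro h
    exact (List.nodup_append.1 hl).2.2 j h j (List.mem_cons_self) rfl
  · exact (List.nodup_cons.1 (List.nodup_append.1 hl).2.1).1

/-- The looks after the one into `j` are made with probability `1 - q`. -/
theorem wordCost_of_mem (G : BoxSearch n) {j : Fin n} {l : List (Fin n)} (hl : l.Nodup)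
    (hj : j ∈ l) :
    G.wordCost j l = G.q * G.arrival j l + (1 - G.q) * G.wordTime l := by
  obtain ⟨l₁, l₂, rfl, h₁, h₂⟩ := exists_split hl hj
  rw [G.arrival_split h₁, wordCost_append, wordCost, G.wordCost_of_notMem h₁,
    G.wordCost_of_notMem h₂, List.count_eq_zero_of_not_mem h₁, wordTime_append, wordTime_cons,
    if_pos rfl]
  ring

/-- In an ordering and its reversal taken together, every box other than `j` precedes `j`
exactly once. -/
theorem arrival_add_arrival_reverse (G : BoxSearch n) {j : Fin n} {l : List (Fin n)}
    (hl : l.Nodup) (hj : j ∈ l) :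
    G.arrival j l + G.arrival j l.reverse = G.wordTime l + G.time j := by
  obtain ⟨l₁, l₂, rfl, h₁, h₂⟩ := exists_split hl hj
  have h : (l₁ ++ j :: l₂).reverse = l₂.reverse ++ j :: l₁.reverse := by simp
  have h' : G.wordTime l₂.reverse = G.wordTime l₂ := by
    rw [wordTime, wordTime, List.map_reverse, List.sum_reverse]
  rw [h, G.arrival_split h₁, G.arrival_split (by simpa using h₂), h', wordTime_append,
    wordTime_cons]
  ring

theorem payoffPure_cons (G : BoxSearch n) (j a : Fin n) (S : Stream' (Fin n)) :
    G.payoffPure (Stream'.cons a S).get j = ENNReal.ofReal (G.time a) +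
      ENNReal.ofReal (if a = j then 1 - G.q else 1) * G.payoffPure S.get j := by
  rw [G.payoffPure_split _ j 1]
  have h : (fun m => (Stream'.cons a S).get (m + 1)) = S.get := rfl
  have h0 : (Stream'.cons a S).get 0 = a := rfl
  rw [h]
  simp only [Finset.sum_range_one, Nat.count_zero, Nat.count_succ, h0, pow_zero, mul_one]
  by_cases ha : a = j <;> simp [ha]

theorem payoffPure_append (G : BoxSearch n) (j : Fin n) (l : List (Fin n))
    (S : Stream' (Fin n)) :
    G.payoffPure (l ++ₛ S).get j = ENNReal.ofReal (G.wordCost j l) +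
      ENNReal.ofReal ((1 - G.q) ^ l.count j) * G.payoffPure S.get j := by
  induction l with
  | nil => simp [wordCost, Stream'.nil_append_stream]
  | cons a l ih =>
    have h0 : (0 : ℝ) ≤ if a = j then 1 - G.q else 1 := by
      split_ifs
      exacts [G.r_pos.le, zero_le_one]
    rw [Stream'.cons_append_stream, payoffPure_cons, ih, wordCost,
      ENNReal.ofReal_add (G.time_pos a).le (mul_nonneg h0 (G.wordCost_nonneg j l)), mul_add,
      ← ENNReal.ofReal_mul h0, ← mul_assoc, ← ENNReal.ofReal_mul h0, add_assoc]
    congr 4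
    rw [List.count_cons]
    by_cases h : a = j
    · simp only [h, if_true, beq_self_eq_true, pow_succ]
      ring
    · simp [h]

theorem payoffPure_append_of_eq (G : BoxSearch n) (j : Fin n) (l : List (Fin n))
    {S : Stream' (Fin n)} {a : ℝ} (ha : 0 ≤ a) (hS : G.payoffPure S.get j = ENNReal.ofReal a) :
    G.payoffPure (l ++ₛ S).get j =
      ENNReal.ofReal (G.wordCost j l + (1 - G.q) ^ l.count j * a) := by
  have hp : 0 ≤ (1 - G.q) ^ l.count j := pow_nonneg G.r_pos.le _
  rw [payoffPure_append, hS, ← ENNReal.ofReal_mul hp,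
    ← ENNReal.ofReal_add (G.wordCost_nonneg j l) (mul_nonneg hp ha)]

/-- The partial sums of the payoff of a periodic search are bounded, since advancing by a period
multiplies the terms by a constant less than one. -/
theorem payoffPure_ne_top_of_periodic (G : BoxSearch n) {S : ℕ → Fin n} {j : Fin n} {L : ℕ}
    (hL : ∀ m, S (m + L) = S m) (hj : Nat.count (fun l => S l = j) L ≠ 0) :
    G.payoffPure S j ≠ ∞ := by
  set g : ℕ → ℝ := fun m => G.time (S m) * (1 - G.q) ^ Nat.count (fun l => S l = j) m with hg
  have hg0 : ∀ m, 0 ≤ g m := fun m => mul_nonneg (G.time_pos _).le (pow_nonneg G.r_pos.le _)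
  set ρ : ℝ := (1 - G.q) ^ Nat.count (fun l => S l = j) L with hρ
  have hρ1 : ρ < 1 := pow_lt_one₀ G.r_pos.le G.r_lt_one hj
  have hper : ∀ m, g (L + m) = ρ * g m := by
    intro m
    have hL' : ∀ m, S (L + m) = S m := fun m => add_comm m L ▸ hL m
    simp only [hg, hρ, Nat.count_add, pow_add, hL']
    ring
  have hbound : ∀ M, ∑ m ∈ Finset.range M, g m ≤ (∑ m ∈ Finset.range L, g m) / (1 - ρ) := by
    intro M
    rw [le_div_iff₀ (sub_pos.2 hρ1)]
    have h1 : ∑ m ∈ Finset.range M, g m ≤ ∑ m ∈ Finset.range (L + M), g m :=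
      Finset.sum_le_sum_of_subset_of_nonneg (Finset.range_mono (Nat.le_add_left _ _))
        fun m _ _ => hg0 m
    rw [Finset.sum_range_add] at h1
    simp only [hper, ← Finset.mul_sum] at h1
    linarith
  rw [payoffPure_eq_tsum]
  exact (summable_of_sum_range_le hg0 hbound).tsum_ofReal_ne_top

theorem cycle_get_add_length (l : List (Fin n)) (hl : l ≠ []) (m : ℕ) :
    (Stream'.cycle l hl).get (m + l.length) = (Stream'.cycle l hl).get m := by
  conv_lhs => rw [Stream'.cycle_eq]
  rw [add_comm, Stream'.get_append_right]

theorem payoffPure_cycle (G : BoxSearch n) {j : Fin n} {l : List (Fin n)} (hl : l ≠ [])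
    (hj : l.count j = 1) :
    G.payoffPure (Stream'.cycle l hl).get j = ENNReal.ofReal (G.wordCost j l / G.q) := by
  have hfin : G.payoffPure (Stream'.cycle l hl).get j ≠ ∞ := by
    refine G.payoffPure_ne_top_of_periodic (cycle_get_add_length l hl) ?_
    have hmem : j ∈ l := List.count_pos_iff.1 (by omega)
    obtain ⟨i, hi, rfl⟩ := List.mem_iff_getElem.1 hmem
    have : 0 < Nat.count (fun m => (Stream'.cycle l hl).get m = l[i]) l.length := by
      rw [Nat.count_eq_card_filter_range]
      refine Finset.card_pos.2 ⟨i, ?_⟩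
      rw [Finset.mem_filter, Finset.mem_range]
      refine ⟨hi, ?_⟩
      rw [Stream'.cycle_eq, Stream'.get_append_left _ _ _ hi]
    exact this.ne'
  have heq := G.payoffPure_append j l (Stream'.cycle l hl)
  rw [← Stream'.cycle_eq, hj, pow_one] at heq
  rw [← ENNReal.ofReal_toReal hfin] at heq ⊢
  set u := (G.payoffPure (Stream'.cycle l hl).get j).toReal
  have hu : 0 ≤ u := ENNReal.toReal_nonneg
  rw [← ENNReal.ofReal_mul G.r_pos.le, ← ENNReal.ofReal_add (G.wordCost_nonneg j l)
    (mul_nonneg G.r_pos.le hu), ENNReal.ofReal_eq_ofReal_iff hu (add_nonneg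
    (G.wordCost_nonneg j l) (mul_nonneg G.r_pos.le hu))] at heq
  congr 1
  rw [eq_div_iff G.q_pos.ne']
  linarith

theorem count_flatten_replicate (k : ℕ) (l : List (Fin n)) (j : Fin n) :
    (List.replicate k l).flatten.count j = k * l.count j := by
  induction k with
  | zero => simp
  | succ k ih => rw [List.replicate_succ, List.flatten_cons, List.count_append, ih]; ring

theorem wordTime_flatten_replicate (G : BoxSearch n) (k : ℕ) (l : List (Fin n)) :
    G.wordTime (List.replicate k l).flatten = k * G.wordTime l := by
  induction k with
  | zero => simp [wordTime]
  | succ k ih =>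
    rw [List.replicate_succ, List.flatten_cons, wordTime_append, ih]
    push_cast
    ring

theorem wordCost_flatten_replicate (G : BoxSearch n) (k : ℕ) {l : List (Fin n)} {j : Fin n}
    (hj : l.count j = 1) :
    G.wordCost j (List.replicate k l).flatten =
      (1 - (1 - G.q) ^ k) / G.q * G.wordCost j l := by
  have hq := G.q_pos.ne'
  induction k with
  | zero => simp [wordCost]
  | succ k ih =>
    rw [List.replicate_succ, List.flatten_cons, wordCost_append, ih, hj]
    field_simp
    ring

/-- The payoff of repeating an ordering of a set of boxes forever. -/
theorem payoffPure_cycle_nodup (G : BoxSearch n) {j : Fin n} {l : List (Fin n)} (h0 : l ≠ [])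
    (hl : l.Nodup) (hj : j ∈ l) :
    G.payoffPure (Stream'.cycle l h0).get j =
      ENNReal.ofReal (G.arrival j l + (1 - G.q) / G.q * G.wordTime l) := by
  have hq := G.q_pos.ne'
  rw [G.payoffPure_cycle h0 (List.count_eq_one_of_mem hl hj), G.wordCost_of_mem hl hj]
  congr 1
  field_simp

/-- The payoff of `alternate k x y` against a box in `x`. -/
theorem payoffPure_alternate_left (G : BoxSearch n) (k : ℕ)
    (x y : {l : List (Fin n) // l ≠ []}) {j : Fin n} (hx : x.1.Nodup) (hj : j ∈ x.1)
    (hjy : j ∉ y.1) :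
    G.payoffPure (alternate k x y) j = ENNReal.ofReal (G.arrival j x.1 +
      ((1 - G.q) / G.q * G.wordTime x.1 + (1 - G.q) ^ k / G.q * G.wordTime y.1)) := by
  have hq := G.q_pos.ne'
  have hxc := List.count_eq_one_of_mem hx hj
  have hyc := List.count_eq_zero_of_not_mem hjy
  rw [alternate, G.payoffPure_append_of_eq j _ _ (G.payoffPure_cycle _ _)]
  · rw [G.wordCost_flatten_replicate k hxc, count_flatten_replicate, hxc, wordCost_append, hyc,
      G.wordCost_of_notMem hjy, G.wordCost_of_mem hx hj]
    congr 1
    field_simp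
    ring
  · exact div_nonneg (G.wordCost_nonneg _ _) G.q_pos.le
  · rw [List.count_append, hxc, hyc]

/-- The payoff of `alternate k x y` against a box in `y`. -/
theorem payoffPure_alternate_right (G : BoxSearch n) (k : ℕ)
    (x y : {l : List (Fin n) // l ≠ []}) {j : Fin n} (hy : y.1.Nodup) (hj : j ∈ y.1)
    (hjx : j ∉ x.1) :
    G.payoffPure (alternate k x y) j = ENNReal.ofReal (G.arrival j y.1 +
      (k * G.wordTime x.1 + (1 - G.q) / G.q * (G.wordTime y.1 + G.wordTime x.1))) := by
  have hq := G.q_pos.ne'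
  have hxc := List.count_eq_zero_of_not_mem hjx
  have hyc := List.count_eq_one_of_mem hy hj
  rw [alternate, G.payoffPure_append_of_eq j _ _ (G.payoffPure_cycle _ _)]
  · rw [count_flatten_replicate, hxc, wordCost_append, hyc, G.wordCost_of_notMem hjx,
      G.wordCost_of_mem hy hj, G.wordCost_of_notMem, wordTime_flatten_replicate]
    · congr 1
      field_simp
      ring
    · rw [← List.count_eq_zero, count_flatten_replicate, hxc, mul_zero]
  · exact div_nonneg (G.wordCost_nonneg _ _) G.q_pos.le
  · rw [List.count_append, hxc, hyc]

/-! ### Expectations under discrete distributions -/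

/-- The expectation of `g` under the discrete distribution `p`. -/
noncomputable def expect {α : Type*} (p : PMF α) (g : α → ℝ≥0∞) : ℝ≥0∞ := ∑' a, p a * g a

section expect

variable {α β : Type*}

theorem expect_bind (p : PMF α) (f : α → PMF β) (g : β → ℝ≥0∞) :
    expect (p.bind f) g = expect p fun a => expect (f a) g := by
  simp only [expect, PMF.bind_apply, ← ENNReal.tsum_mul_right, ← ENNReal.tsum_mul_left]
  rw [ENNReal.tsum_comm]
  simp only [mul_assoc]

theorem expect_pure (a : α) (g : α → ℝ≥0∞) : expect (PMF.pure a) g = g a := by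
  classical
  rw [expect, tsum_eq_single a]
  · simp
  · intro b hb
    simp [PMF.pure_apply, hb]

theorem expect_map (p : PMF α) (f : α → β) (g : β → ℝ≥0∞) :
    expect (p.map f) g = expect p fun a => g (f a) := by
  rw [PMF.map, expect_bind]
  simp only [Function.comp, expect_pure]

theorem expect_congr {p : PMF α} {g g' : α → ℝ≥0∞} (h : ∀ a ∈ p.support, g a = g' a) :
    expect p g = expect p g' := by
  refine tsum_congr fun a => ?_
  by_cases ha : p a = 0
  · simp [ha]
  · rw [h a ((PMF.mem_support_iff _ _).2 ha)]

theorem expect_const (p : PMF α) (c : ℝ≥0∞) : expect p (fun _ => c) = c := by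
  rw [expect, ENNReal.tsum_mul_right, p.tsum_coe, one_mul]

theorem expect_add (p : PMF α) (g g' : α → ℝ≥0∞) :
    expect p (fun a => g a + g' a) = expect p g + expect p g' := by
  simp only [expect, mul_add, ENNReal.tsum_add]

theorem le_expect {p : PMF α} {g : α → ℝ≥0∞} {c : ℝ≥0∞} (h : ∀ a, c ≤ g a) :
    c ≤ expect p g := by
  rw [← expect_const p c]
  exact ENNReal.tsum_le_tsum fun a => mul_le_mul_right (h a) _

theorem expect_sum {ι : Type*} (p : PMF α) (s : Finset ι) (w : ι → ℝ≥0∞) (g : α → ι → ℝ≥0∞) :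
    expect p (fun a => ∑ i ∈ s, w i * g a i) = ∑ i ∈ s, w i * expect p fun a => g a i := by
  simp only [expect, Finset.mul_sum, ← ENNReal.tsum_mul_left]
  rw [Summable.tsum_finsetSum fun _ _ => ENNReal.summable]
  simp only [mul_left_comm]

/-- A function that is bounded below by its (finite) expectation attains it. -/
theorem exists_eq_of_expect_eq {p : PMF α} {g : α → ℝ≥0∞} {c : ℝ≥0∞} (hc : c ≠ ∞)
    (h : ∀ a, c ≤ g a) (hE : expect p g = c) : ∃ a, g a = c := by
  by_contra! hne
  obtain ⟨a, ha⟩ := p.support_nonempty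
  have hlt : expect p (fun _ => c) < expect p g := by
    refine ENNReal.tsum_lt_tsum (i := a) ?_ (fun b => mul_le_mul_right (h b) _) ?_
    · rw [← expect, expect_const]
      exact hc
    · exact ENNReal.mul_lt_mul_right ((PMF.mem_support_iff _ _).1 ha) (p.apply_ne_top a)
        (lt_of_le_of_ne (h a) (hne a).symm)
  rw [expect_const, hE] at hlt
  exact lt_irrefl _ hlt

end expect

/-! ### The random ordering `s_Z` -/

/-- The expected total time, under the random ordering `s_Z`, of the looks up to and including the
look into a given box of `Z`. It does not depend on the box. -/
noncomputable def meanArrival (G : BoxSearch n) (Z : Finset (Fin n)) : ℝ :=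
  (G.t Z + (∑ i ∈ Z, G.time i ^ 2) / G.t Z) / 2

theorem t_pos (G : BoxSearch n) {Z : Finset (Fin n)} (hZ : Z.Nonempty) : 0 < G.t Z :=
  Finset.sum_pos (fun i _ => G.time_pos i) hZ

theorem meanArrival_nonneg (G : BoxSearch n) {Z : Finset (Fin n)} (hZ : Z.Nonempty) :
    0 ≤ G.meanArrival Z := by
  have := G.t_pos hZ
  rw [meanArrival]
  positivity

theorem sum_sq_le (G : BoxSearch n) (Z : Finset (Fin n)) :
    ∑ i ∈ Z, G.time i ^ 2 ≤ G.t Z ^ 2 :=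
  Finset.sum_sq_le_sq_sum_of_nonneg fun i _ => (G.time_pos i).le

theorem sum_lt_mul (G : BoxSearch n) (Z : Finset (Fin n)) :
    2 * ∑ i ∈ Z, ∑ j ∈ Z with i < j, G.time i * G.time j =
      G.t Z ^ 2 - ∑ i ∈ Z, G.time i ^ 2 := by
  have h1 : ∑ i ∈ Z, ∑ j ∈ Z with i < j, G.time i * G.time j =
      ∑ i ∈ Z, ∑ j ∈ Z, if j < i then G.time i * G.time j else 0 := by
    simp only [Finset.sum_filter]
    rw [Finset.sum_comm]
    simp only [mul_comm]
  have h2 : G.t Z ^ 2 = ∑ i ∈ Z, ∑ j ∈ Z, G.time i * G.time j := by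
    rw [sq, t, Finset.sum_mul_sum]
  have h3 : ∑ i ∈ Z, G.time i ^ 2 =
      ∑ i ∈ Z, ∑ j ∈ Z, if i = j then G.time i * G.time j else 0 := by
    refine Finset.sum_congr rfl fun i hi => ?_
    rw [Finset.sum_ite_eq, if_pos hi, sq]
  rw [two_mul]
  nth_rewrite 2 [h1]
  rw [eq_sub_iff_add_eq, h2, h3]
  simp only [Finset.sum_filter, ← Finset.sum_add_distrib]
  refine Finset.sum_congr rfl fun i _ => Finset.sum_congr rfl fun j _ => ?_
  rcases lt_trichotomy i j with h | h | h
  · simp [h, h.ne, h.not_gt]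
  · simp [h]
  · simp [h, h.ne', h.not_gt]

theorem V_eq_meanArrival (G : BoxSearch n) {Z : Finset (Fin n)} (hZ : Z.Nonempty) :
    G.V Z = G.meanArrival Z + (1 - G.q) / G.q * G.t Z := by
  have ht := (G.t_pos hZ).ne'
  have hq := G.q_pos.ne'
  have h := G.sum_lt_mul Z
  rw [V, meanArrival]
  generalize ∑ i ∈ Z, ∑ j ∈ Z with i < j, G.time i * G.time j = A at *
  generalize ∑ i ∈ Z, G.time i ^ 2 = B at *
  have hA : A = (G.t Z ^ 2 - B) / 2 := by linarith
  rw [hA]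
  field_simp
  ring

theorem V_pos (G : BoxSearch n) {Z : Finset (Fin n)} (hZ : Z.Nonempty) : 0 < G.V Z := by
  rw [G.V_eq_meanArrival hZ]
  exact add_pos_of_nonneg_of_pos (G.meanArrival_nonneg hZ)
    (mul_pos (div_pos G.r_pos G.q_pos) (G.t_pos hZ))

theorem wordTime_eq_t (G : BoxSearch n) {Z : Finset (Fin n)} {l : List (Fin n)}
    (h : (l : Multiset (Fin n)) = Z.val) : G.wordTime l = G.t Z := by
  rw [t, Finset.sum, ← h, Multiset.map_coe, Multiset.sum_coe, wordTime]

theorem nodup_of_coe_eq {Z : Finset (Fin n)} {l : List (Fin n)}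
    (h : (l : Multiset (Fin n)) = Z.val) : l.Nodup := by
  rw [← Multiset.coe_nodup, h]
  exact Z.nodup

theorem mem_of_coe_eq {Z : Finset (Fin n)} {l : List (Fin n)}
    (h : (l : Multiset (Fin n)) = Z.val) (j : Fin n) : j ∈ l ↔ j ∈ Z := by
  rw [← Multiset.mem_coe, h, Finset.mem_val]

theorem mem_support_uniformOrder {Z : Finset (Fin n)} {l : List (Fin n)} :
    l ∈ (uniformOrder Z).support ↔ (l : Multiset (Fin n)) = Z.val := by
  rw [uniformOrder, PMF.support_uniformOfFinset, Finset.mem_coe, Finset.mem_mk,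
    Multiset.mem_lists_iff]
  exact eq_comm

theorem coe_eq_of_mem_support_order (G : BoxSearch n) {Z : Finset (Fin n)} {hZ : Z.Nonempty}
    {x : {l : List (Fin n) // l ≠ []}} (hx : x ∈ (G.order Z hZ).support) :
    (x.1 : Multiset (Fin n)) = Z.val := by
  rw [order, PMF.mem_support_bind_iff] at hx
  obtain ⟨j, hj, hx⟩ := hx
  rw [PMF.mem_support_map_iff] at hx
  obtain ⟨l, hl, rfl⟩ := hx
  rw [mem_support_uniformOrder] at hl
  have hjZ : j ∈ Z := by
    rw [firstBox, PMF.mem_support_normalize_iff] at hj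
    by_contra h
    simp [h] at hj
  change ((j :: l : List (Fin n)) : Multiset (Fin n)) = Z.val
  rw [← Multiset.cons_coe, hl, Finset.erase_val]
  exact Multiset.cons_erase hjZ

/-- In a uniformly random ordering, every other box precedes `j` with probability `1/2`. -/
theorem expect_arrival_uniformOrder (G : BoxSearch n) {W : Finset (Fin n)} {j : Fin n}
    (hj : j ∈ W) :
    expect (uniformOrder W) (fun l => ENNReal.ofReal (G.arrival j l)) =
      ENNReal.ofReal ((G.t W + G.time j) / 2) := by
  set s : Finset (List (Fin n)) := ⟨Multiset.lists W.val, Multiset.lists_nodup_finset W⟩ with hs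
  have hmem : ∀ l, l ∈ s ↔ (l : Multiset (Fin n)) = W.val := by
    intro l
    rw [hs, Finset.mem_mk, Multiset.mem_lists_iff]
    exact eq_comm
  have hne : s.Nonempty := ⟨W.toList, (hmem _).2 (Finset.coe_toList W)⟩
  have hcard : (0 : ℝ) < s.card := Nat.cast_pos.2 hne.card_pos
  have hrev : ∑ l ∈ s, G.arrival j l.reverse = ∑ l ∈ s, G.arrival j l := by
    refine Finset.sum_nbij' List.reverse List.reverse ?_ ?_ ?_ ?_ ?_ <;> intro l hl
    · rw [hmem] at hl ⊢
      rw [Multiset.coe_reverse, hl]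
    · rw [hmem] at hl ⊢
      rw [Multiset.coe_reverse, hl]
    · exact List.reverse_reverse l
    · exact List.reverse_reverse l
    · rfl
  have hsum : ∑ l ∈ s, G.arrival j l = s.card * ((G.t W + G.time j) / 2) := by
    have h : ∑ l ∈ s, (G.arrival j l + G.arrival j l.reverse) =
        s.card * (G.t W + G.time j) := by
      rw [← nsmul_eq_mul, ← Finset.sum_const]
      refine Finset.sum_congr rfl fun l hl => ?_
      rw [hmem] at hl
      rw [G.arrival_add_arrival_reverse (nodup_of_coe_eq hl) ((mem_of_coe_eq hl j).2 hj),
        G.wordTime_eq_t hl]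
    rw [Finset.sum_add_distrib, hrev] at h
    linarith
  have hE : expect (uniformOrder W) (fun l => ENNReal.ofReal (G.arrival j l)) =
      ∑ l ∈ s, (s.card : ℝ≥0∞)⁻¹ * ENNReal.ofReal (G.arrival j l) := by
    rw [expect, tsum_eq_sum (s := s)]
    · refine Finset.sum_congr rfl fun l hl => ?_
      rw [uniformOrder, PMF.uniformOfFinset_apply_of_mem _ hl]
    · intro l hl
      rw [uniformOrder, PMF.uniformOfFinset_apply_of_notMem _ hl, zero_mul]
  rw [hE, ← Finset.mul_sum, ← ENNReal.ofReal_sum_of_nonneg fun l _ => G.arrival_nonneg j l, hsum,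
    ENNReal.ofReal_mul hcard.le, ENNReal.ofReal_natCast, ← mul_assoc,
    ENNReal.inv_mul_cancel (Nat.cast_ne_zero.2 hne.card_pos.ne') (ENNReal.natCast_ne_top _),
    one_mul]

theorem expect_firstBox (G : BoxSearch n) {Z : Finset (Fin n)} (hZ : Z.Nonempty)
    {f : Fin n → ℝ≥0∞} {g : Fin n → ℝ} (hg : ∀ i ∈ Z, 0 ≤ g i)
    (hf : ∀ i ∈ Z, f i = ENNReal.ofReal (g i)) :
    expect (G.firstBox Z hZ) f = ENNReal.ofReal ((∑ i ∈ Z, G.time i * g i) / G.t Z) := by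
  have htot : (∑' i, if i ∈ Z then ENNReal.ofReal (G.time i) else 0) =
      ENNReal.ofReal (G.t Z) := by
    rw [tsum_fintype, Finset.sum_ite_mem, Finset.univ_inter, t,
      ENNReal.ofReal_sum_of_nonneg fun i _ => (G.time_pos i).le]
  have h0 : ∀ i ∈ Z, 0 ≤ G.time i * g i := fun i hi => mul_nonneg (G.time_pos i).le (hg i hi)
  rw [expect, tsum_fintype, ENNReal.ofReal_div_of_pos (G.t_pos hZ),
    ENNReal.ofReal_sum_of_nonneg h0, div_eq_mul_inv, Finset.sum_mul,
    ← Finset.sum_subset (Finset.subset_univ Z)]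
  · refine Finset.sum_congr rfl fun i hi => ?_
    rw [firstBox, PMF.normalize_apply, htot, if_pos hi, hf i hi, ENNReal.ofReal_mul
      (G.time_pos i).le, mul_right_comm]
  · intro i _ hi
    rw [firstBox, PMF.normalize_apply, if_neg hi, zero_mul, zero_mul]

/-- Choosing the first box proportionally to its search time makes the expected arrival times of
all boxes of `Z` equal. -/
theorem expect_arrival_order (G : BoxSearch n) {Z : Finset (Fin n)} (hZ : Z.Nonempty) {j : Fin n}
    (hj : j ∈ Z) :
    expect (G.order Z hZ) (fun x => ENNReal.ofReal (G.arrival j x.1)) =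
      ENNReal.ofReal (G.meanArrival Z) := by
  have ht := G.t_pos hZ
  rw [order, expect_bind]
  simp only [expect_map]
  rw [G.expect_firstBox hZ
    (g := fun i => (G.t Z + G.time i + G.time j) / 2 - if i = j then G.t Z / 2 else 0)]
  · congr 1
    simp only [mul_sub, Finset.sum_sub_distrib, mul_ite, mul_zero, Finset.sum_ite_eq', hj,
      if_true]
    have h : ∑ i ∈ Z, G.time i * ((G.t Z + G.time i + G.time j) / 2) =
        (G.t Z * (G.t Z + G.time j) + ∑ i ∈ Z, G.time i ^ 2) / 2 := by
      conv_rhs => rw [t, Finset.sum_mul, ← Finset.sum_add_distrib, Finset.sum_div]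
      refine Finset.sum_congr rfl fun i _ => ?_
      rw [t]
      ring
    rw [h, meanArrival]
    field_simp
    ring
  · intro i hi
    have hp := G.time_pos i
    have hp' := G.time_pos j
    split_ifs
    · linarith
    · linarith
  · intro i hi
    by_cases hij : i = j
    · subst hij
      simp only [arrival, if_true, add_zero, expect_const]
      congr 1
      ring
    · have hjW : j ∈ Z.erase i := Finset.mem_erase.2 ⟨Ne.symm hij, hj⟩
      simp only [arrival, if_neg hij]
      have hW : G.t (Z.erase i) = G.t Z - G.time i :=
        eq_sub_of_add_eq (Finset.sum_erase_add Z G.time hi)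
      have hnn : 0 ≤ G.t (Z.erase i) := Finset.sum_nonneg fun a _ => (G.time_pos a).le
      have hp := G.time_pos j
      simp only [ENNReal.ofReal_add (G.time_pos i).le (G.arrival_nonneg j _)]
      rw [expect_add, expect_const, G.expect_arrival_uniformOrder hjW,
        ← ENNReal.ofReal_add (G.time_pos i).le (by linarith), hW]
      congr 1
      ring

theorem expect_arrival_add (G : BoxSearch n) {Z : Finset (Fin n)} (hZ : Z.Nonempty) {j : Fin n}
    (hj : j ∈ Z) {c : ℝ} (hc : 0 ≤ c) :
    expect (G.order Z hZ) (fun x => ENNReal.ofReal (G.arrival j x.1 + c)) =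
      ENNReal.ofReal (G.meanArrival Z + c) := by
  simp only [ENNReal.ofReal_add (G.arrival_nonneg j _) hc]
  rw [expect_add, expect_const, G.expect_arrival_order hZ hj,
    ENNReal.ofReal_add (G.meanArrival_nonneg hZ) hc]

/-! ### The payoffs of the mixed searches -/

/-- The mixed search that repeats an ordering drawn from `s_Z` forever. -/
noncomputable def repeatOrder (G : BoxSearch n) (Z : Finset (Fin n)) (hZ : Z.Nonempty) :
    MixedSearch n :=
  ⟨(G.order Z hZ).map fun x => (Stream'.cycle x.1 x.2).get, by
    rw [PMF.support_map]
    exact (G.order_support_finite Z hZ).image _⟩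

theorem payoff_repeatOrder (G : BoxSearch n) {Z : Finset (Fin n)} (hZ : Z.Nonempty) {j : Fin n}
    (hj : j ∈ Z) : G.payoff (G.repeatOrder Z hZ) j = ENNReal.ofReal (G.V Z) := by
  have hc : 0 ≤ (1 - G.q) / G.q * G.t Z :=
    mul_nonneg (div_pos G.r_pos G.q_pos).le (G.t_pos hZ).le
  change expect ((G.order Z hZ).map _) (fun S => G.payoffPure S j) = _
  rw [expect_map, G.V_eq_meanArrival hZ, ← G.expect_arrival_add hZ hj hc]
  refine expect_congr fun x hx => ?_
  have h := G.coe_eq_of_mem_support_order hx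
  rw [G.payoffPure_cycle_nodup x.2 (nodup_of_coe_eq h) ((mem_of_coe_eq h j).2 hj),
    G.wordTime_eq_t h]

/-- The payoff of the search `s^k` against the boxes outside `H`. -/
noncomputable def outer (G : BoxSearch n) (H : Finset (Fin n)) (k : ℕ) : ℝ :=
  G.V Hᶜ + (k + (1 - G.q) / G.q) * G.t H

theorem payoff_sk_of_mem (G : BoxSearch n) {H : Finset (Fin n)} (hH : H.Nonempty)
    (hHc : Hᶜ.Nonempty) (k : ℕ) {j : Fin n} (hj : j ∈ H) :
    G.payoff (G.sk H hH hHc k) j = ENNReal.ofReal (G.v H k) := by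
  have hc : 0 ≤ (1 - G.q) / G.q * G.t H + (1 - G.q) ^ k / G.q * G.t Hᶜ :=
    add_nonneg (mul_nonneg (div_pos G.r_pos G.q_pos).le (G.t_pos hH).le)
      (mul_nonneg (div_pos (pow_pos G.r_pos k) G.q_pos).le (G.t_pos hHc).le)
  change expect ((G.order H hH).bind _) (fun S => G.payoffPure S j) = _
  rw [expect_bind, v, G.V_eq_meanArrival hH, add_assoc, ← G.expect_arrival_add hH hj hc]
  refine expect_congr fun x hx => ?_
  have h := G.coe_eq_of_mem_support_order hx
  rw [expect_map, ← expect_const (G.order Hᶜ hHc) (ENNReal.ofReal _)]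
  refine expect_congr fun y hy => ?_
  have h' := G.coe_eq_of_mem_support_order hy
  rw [G.payoffPure_alternate_left k x y (nodup_of_coe_eq h) ((mem_of_coe_eq h j).2 hj) (by
    rw [mem_of_coe_eq h' j, Finset.mem_compl]
    exact fun hn => hn hj), G.wordTime_eq_t h, G.wordTime_eq_t h']

theorem payoff_sk_of_notMem (G : BoxSearch n) {H : Finset (Fin n)} (hH : H.Nonempty)
    (hHc : Hᶜ.Nonempty) (k : ℕ) {j : Fin n} (hj : j ∈ Hᶜ) :
    G.payoff (G.sk H hH hHc k) j = ENNReal.ofReal (G.outer H k) := by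
  have hc : 0 ≤ k * G.t H + (1 - G.q) / G.q * (G.t Hᶜ + G.t H) :=
    add_nonneg (mul_nonneg (Nat.cast_nonneg k) (G.t_pos hH).le)
      (mul_nonneg (div_pos G.r_pos G.q_pos).le (add_pos (G.t_pos hHc) (G.t_pos hH)).le)
  have hout : G.outer H k = G.meanArrival Hᶜ +
      (k * G.t H + (1 - G.q) / G.q * (G.t Hᶜ + G.t H)) := by
    rw [outer, G.V_eq_meanArrival hHc]
    ring
  change expect ((G.order H hH).bind _) (fun S => G.payoffPure S j) = _
  rw [expect_bind, hout, ← expect_const (G.order H hH) (ENNReal.ofReal _)]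
  refine expect_congr fun x hx => ?_
  have h := G.coe_eq_of_mem_support_order hx
  rw [expect_map, ← G.expect_arrival_add hHc hj hc]
  refine expect_congr fun y hy => ?_
  have h' := G.coe_eq_of_mem_support_order hy
  rw [G.payoffPure_alternate_right k x y (nodup_of_coe_eq h') ((mem_of_coe_eq h' j).2 hj) (by
    rw [mem_of_coe_eq h j]
    exact Finset.mem_compl.1 hj), G.wordTime_eq_t h, G.wordTime_eq_t h']

theorem payoff_mix (G : BoxSearch n) (β : unitInterval) (s s' : MixedSearch n) (j : Fin n)
    {a b : ℝ} (ha : 0 ≤ a) (hb : 0 ≤ b) (hs : G.payoff s j = ENNReal.ofReal a)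
    (hs' : G.payoff s' j = ENNReal.ofReal b) :
    G.payoff (mix β s s') j = ENNReal.ofReal ((1 - β) * a + β * b) := by
  have h1 : (0 : ℝ) ≤ 1 - β := sub_nonneg.2 β.2.2
  have h2 : (0 : ℝ) ≤ β := β.2.1
  rw [ENNReal.ofReal_add (mul_nonneg h1 ha) (mul_nonneg h2 hb), ENNReal.ofReal_mul h1,
    ENNReal.ofReal_mul h2, ← hs, ← hs', payoff, payoff, payoff, ← ENNReal.tsum_mul_left,
    ← ENNReal.tsum_mul_left, ← ENNReal.tsum_add]
  refine tsum_congr fun S => ?_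
  change (ENNReal.ofReal (1 - β) * s.1 S + ENNReal.ofReal β * s'.1 S) * _ = _
  ring

/-! ### Lower bounds for mixed searches -/

theorem potential_le_payoff_mixed (G : BoxSearch n) (Z : Finset (Fin n)) (b : Fin n → ℕ)
    (s : MixedSearch n) :
    ENNReal.ofReal (G.potential Z b) ≤
      ∑ j ∈ Z, ENNReal.ofReal (G.time j * (1 - G.q) ^ b j) * G.payoff s j := by
  change _ ≤ ∑ j ∈ Z, _ * expect s.1 (fun S => G.payoffPure S j)
  rw [← expect_sum]
  exact le_expect fun S => G.potential_le_payoff Z b S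

theorem t_mul_V (G : BoxSearch n) {Z : Finset (Fin n)} (hZ : Z.Nonempty) :
    G.t Z * G.V Z = ((∑ i ∈ Z, G.time i ^ 2) + G.t Z ^ 2 * (2 / G.q - 1)) / 2 := by
  have ht := (G.t_pos hZ).ne'
  have hq := G.q_pos.ne'
  rw [G.V_eq_meanArrival hZ, meanArrival]
  field_simp
  ring

theorem potential_zero (G : BoxSearch n) {Z : Finset (Fin n)} (hZ : Z.Nonempty) :
    G.potential Z (fun _ => 0) = G.t Z * G.V Z := by
  rw [G.t_mul_V hZ, potential]
  simp only [pairPotential_self, pow_zero, mul_one, one_mul, ← Finset.sum_mul]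
  rw [sq (G.t Z), t, Finset.sum_mul_sum]

/-- The hiding distribution with probabilities `t_j / t(Z)` on `Z`. -/
noncomputable def proportionalHider (G : BoxSearch n) (Z : Finset (Fin n)) (j : Fin n) : ℝ :=
  if j ∈ Z then G.time j / G.t Z else 0

theorem proportionalHider_mem (G : BoxSearch n) {Z : Finset (Fin n)} (hZ : Z.Nonempty) :
    G.proportionalHider Z ∈ stdSimplex ℝ (Fin n) := by
  have ht := G.t_pos hZ
  constructor
  · intro j
    rw [proportionalHider]
    split_ifs
    exacts [div_nonneg (G.time_pos j).le ht.le, le_rfl]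
  · simp only [proportionalHider]
    rw [Finset.sum_ite_mem, Finset.univ_inter, ← Finset.sum_div]
    exact div_self ht.ne'

theorem V_le_payoffHider (G : BoxSearch n) {Z : Finset (Fin n)} (hZ : Z.Nonempty)
    (S : ℕ → Fin n) :
    ENNReal.ofReal (G.V Z) ≤ G.payoffHider S (G.proportionalHider Z) := by
  have ht := G.t_pos hZ
  have h := mul_le_mul_right (G.potential_le_payoff Z (fun _ => 0) S)
    (ENNReal.ofReal (G.t Z)⁻¹)
  rw [G.potential_zero hZ, ← ENNReal.ofReal_mul (inv_pos.2 ht).le, inv_mul_cancel_left₀ ht.ne']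
    at h
  refine h.trans (le_of_eq ?_)
  rw [payoffHider, Finset.mul_sum, ← Finset.sum_subset (Finset.subset_univ Z)]
  · refine Finset.sum_congr rfl fun j hj => ?_
    rw [← mul_assoc, ← ENNReal.ofReal_mul (inv_pos.2 ht).le, proportionalHider, if_pos hj,
      pow_zero, mul_one, div_eq_inv_mul]
  · intro j _ hj
    rw [proportionalHider, if_neg hj, ENNReal.ofReal_zero, zero_mul]

theorem expect_payoffHider (G : BoxSearch n) (s : MixedSearch n) (h : Fin n → ℝ) :
    expect s.1 (fun S => G.payoffHider S h) = ∑ j, ENNReal.ofReal (h j) * G.payoff s j :=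
  expect_sum _ _ _ _

theorem sum_ofReal_eq_one {h : Fin n → ℝ} (hh : h ∈ stdSimplex ℝ (Fin n)) :
    ∑ j, ENNReal.ofReal (h j) = 1 := by
  rw [← ENNReal.ofReal_sum_of_nonneg fun j _ => hh.1 j, hh.2, ENNReal.ofReal_one]

theorem sum_mul_payoff_le (G : BoxSearch n) (s : MixedSearch n) {h : Fin n → ℝ}
    (hh : h ∈ stdSimplex ℝ (Fin n)) {Z : Finset (Fin n)} (hZ : ∀ j ∉ Z, h j = 0) {c : ℝ≥0∞}
    (hc : ∀ j ∈ Z, G.payoff s j ≤ c) : ∑ j, ENNReal.ofReal (h j) * G.payoff s j ≤ c := by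
  calc ∑ j, ENNReal.ofReal (h j) * G.payoff s j ≤ ∑ j, ENNReal.ofReal (h j) * c := by
        refine Finset.sum_le_sum fun j _ => ?_
        by_cases hj : j ∈ Z
        · exact mul_le_mul_right (hc j hj) _
        · rw [hZ j hj, ENNReal.ofReal_zero, zero_mul, zero_mul]
    _ = c := by rw [← Finset.sum_mul, sum_ofReal_eq_one hh, one_mul]

theorem hasValue_V (G : BoxSearch n) {Z : Finset (Fin n)} (hZ : Z.Nonempty) :
    G.HasValue Z (G.V Z) := by
  have hsupp : ∀ j ∉ Z, G.proportionalHider Z j = 0 := fun j hj => if_neg hj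
  constructor
  · apply le_antisymm
    · exact iInf_le_of_le (G.repeatOrder Z hZ)
        (iSup₂_le fun j hj => (G.payoff_repeatOrder hZ hj).le)
    · refine le_iInf fun s => ?_
      refine le_trans (le_expect (p := s.1) (G.V_le_payoffHider hZ)) ?_
      rw [expect_payoffHider]
      exact G.sum_mul_payoff_le s (G.proportionalHider_mem hZ) hsupp
        fun j hj => le_iSup₂ (f := fun j _ => G.payoff s j) j hj
  · apply le_antisymm
    · refine iSup₂_le fun h hh => ?_
      refine le_trans (le_expect (p := (G.repeatOrder Z hZ).1) (iInf_le _)) ?_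
      rw [expect_payoffHider]
      exact G.sum_mul_payoff_le _ hh.1 hh.2 fun j hj => (G.payoff_repeatOrder hZ hj).le
    · exact le_iSup₂_of_le (G.proportionalHider Z) ⟨G.proportionalHider_mem hZ, hsupp⟩
        (le_iInf (G.V_le_payoffHider hZ))

/-! ### The hiding distributions `h^k` -/

variable (G : BoxSearch n) {H : Finset (Fin n)}

theorem t_univ (H : Finset (Fin n)) : G.t Finset.univ = G.t H + G.t Hᶜ :=
  (Finset.sum_add_sum_compl H _).symm

/-- The exponents of the residual weights for which the potential is proportional to the cost
against `h^k`; the common factor `(1-q)^k` makes them natural numbers. -/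
def shift (H : Finset (Fin n)) (k : ℕ) (j : Fin n) : ℕ := if j ∈ H then 0 else k

theorem hider_eq (H : Finset (Fin n)) (k : ℕ) (j : Fin n) :
    G.hider H k j = G.lam H k / (1 - G.q) ^ k * (G.time j * (1 - G.q) ^ shift H k j) := by
  have hr := (pow_pos G.r_pos k).ne'
  rw [hider, shift]
  split_ifs
  · rw [pow_zero]
    ring
  · field_simp

theorem potential_shift (hH : H.Nonempty) (k : ℕ) :
    G.potential Finset.univ (shift H k) = (1 - G.q) ^ k * G.rhs H k := by
  have hr := (pow_pos G.r_pos k).ne'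
  have hY : (Finset.univ : Finset (Fin n)).Nonempty := hH.mono (Finset.subset_univ _)
  have hrhs : (1 - G.q) ^ k * G.rhs H k = (1 - G.q) ^ k * (G.t Finset.univ * G.V Finset.univ) +
      (1 - (1 - G.q) ^ k) * (G.t H * G.V H) + (1 - G.q) ^ k * (k * (G.t H * G.t Hᶜ)) := by
    rw [rhs]
    field_simp
  have hsplit : ∀ f : Fin n → ℝ, ∑ i, f i = ∑ i ∈ H, f i + ∑ i ∈ Hᶜ, f i := fun f =>
    (Finset.sum_add_sum_compl H f).symm
  have hin : ∀ i ∈ H, shift H k i = 0 := fun i hi => if_pos hi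
  have hout : ∀ i ∈ Hᶜ, shift H k i = k := fun i hi => if_neg (Finset.mem_compl.1 hi)
  have h0k : G.pairPotential 0 k = (1 - G.q) ^ k * (k + (2 / G.q - 1)) := by
    simp [pairPotential]
  have hdouble : ∀ (A B : Finset (Fin n)) (a b : ℕ), (∀ i ∈ A, shift H k i = a) →
      (∀ i ∈ B, shift H k i = b) → ∑ i ∈ A, ∑ j ∈ B,
        G.time i * G.time j * G.pairPotential (shift H k i) (shift H k j) =
        G.t A * G.t B * G.pairPotential a b := by
    intro A B a b hA hB
    rw [t, t, Finset.sum_mul_sum, Finset.sum_mul]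
    refine Finset.sum_congr rfl fun i hi => ?_
    rw [Finset.sum_mul]
    refine Finset.sum_congr rfl fun j hj => ?_
    rw [hA i hi, hB j hj]
  have hsingle : ∀ (A : Finset (Fin n)) (a : ℕ), (∀ i ∈ A, shift H k i = a) →
      ∑ i ∈ A, G.time i ^ 2 * (1 - G.q) ^ shift H k i =
        (∑ i ∈ A, G.time i ^ 2) * (1 - G.q) ^ a := by
    intro A a hA
    rw [Finset.sum_mul]
    exact Finset.sum_congr rfl fun i hi => by rw [hA i hi]
  rw [hrhs, G.t_mul_V hY, G.t_mul_V hH, G.t_univ H, potential, hsplit, hsplit, hsplit,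
    hsingle H 0 hin, hsingle Hᶜ k hout]
  simp only [hsplit fun j => G.time _ * G.time j * G.pairPotential _ (shift H k j),
    Finset.sum_add_distrib]
  rw [hdouble H H 0 0 hin hin, hdouble H Hᶜ 0 k hin hout, hdouble Hᶜ H k 0 hout hin,
    hdouble Hᶜ Hᶜ k k hout hout, G.pairPotential_comm k 0, h0k, pairPotential_self,
    pairPotential_self]
  ring

theorem lam_pos (hH : H.Nonempty) (k : ℕ) : 0 < G.lam H k :=
  inv_pos.2 (add_pos_of_pos_of_nonneg (div_pos (G.t_pos hH) (pow_pos G.r_pos k))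
    (Finset.sum_nonneg fun i _ => (G.time_pos i).le))

theorem sum_hider_mul (H : Finset (Fin n)) (k : ℕ) (a b : ℝ) :
    ∑ j, G.hider H k j * (if j ∈ H then a else b) =
      G.lam H k * (G.t H / (1 - G.q) ^ k * a + G.t Hᶜ * b) := by
  rw [← Finset.sum_add_sum_compl H]
  have h1 : ∑ j ∈ H, G.hider H k j * (if j ∈ H then a else b) =
      G.lam H k * (G.t H / (1 - G.q) ^ k * a) := by
    rw [t, Finset.sum_div, Finset.sum_mul, Finset.mul_sum]
    refine Finset.sum_congr rfl fun j hj => ?_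
    rw [hider, if_pos hj, if_pos hj]
    ring
  have h2 : ∑ j ∈ Hᶜ, G.hider H k j * (if j ∈ H then a else b) =
      G.lam H k * (G.t Hᶜ * b) := by
    rw [t, Finset.sum_mul, Finset.mul_sum]
    refine Finset.sum_congr rfl fun j hj => ?_
    rw [Finset.mem_compl] at hj
    rw [hider, if_neg hj, if_neg hj]
    ring
  rw [h1, h2, mul_add]

theorem hider_nonneg (hH : H.Nonempty) (k : ℕ) (j : Fin n) : 0 ≤ G.hider H k j := by
  rw [hider_eq]
  exact mul_nonneg (div_pos (G.lam_pos hH k) (pow_pos G.r_pos k)).le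
    (mul_pos (G.time_pos j) (pow_pos G.r_pos _)).le

theorem hider_mem (hH : H.Nonempty) (k : ℕ) : G.hider H k ∈ stdSimplex ℝ (Fin n) := by
  refine ⟨G.hider_nonneg hH k, ?_⟩
  have h := G.sum_hider_mul H k 1 1
  simp only [ite_self, mul_one] at h
  rw [h]
  exact inv_mul_cancel₀ (inv_pos.1 (G.lam_pos hH k)).ne'

theorem le_payoffHider_hider (hH : H.Nonempty) (k : ℕ) (S : ℕ → Fin n) :
    ENNReal.ofReal (G.lam H k * G.rhs H k) ≤ G.payoffHider S (G.hider H k) := by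
  have hr := pow_pos G.r_pos k
  have hc : 0 ≤ G.lam H k / (1 - G.q) ^ k := (div_pos (G.lam_pos hH k) hr).le
  have h := mul_le_mul_right (G.potential_le_payoff Finset.univ (shift H k) S)
    (ENNReal.ofReal (G.lam H k / (1 - G.q) ^ k))
  rw [G.potential_shift hH, ← ENNReal.ofReal_mul hc, ← mul_assoc,
    div_mul_cancel₀ _ hr.ne', Finset.mul_sum] at h
  refine h.trans (le_of_eq (Finset.sum_congr rfl fun j _ => ?_))
  rw [hider_eq, ENNReal.ofReal_mul hc, mul_assoc]

/-- Averaging over `h^k` turns the bound for pure searches into a linear inequality between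
consistency and robustness. -/
theorem rhs_le (hH : H.Nonempty) (k : ℕ) (s : MixedSearch n) :
    ENNReal.ofReal (G.rhs H k) ≤
      ENNReal.ofReal (G.t H / (1 - G.q) ^ k) * G.consistency H s +
        ENNReal.ofReal (G.t Hᶜ) * G.robustness s := by
  have hr := pow_pos G.r_pos k
  have hr0 : ENNReal.ofReal ((1 - G.q) ^ k) ≠ 0 := (ENNReal.ofReal_pos.2 hr).ne'
  have h := G.potential_le_payoff_mixed Finset.univ (shift H k) s
  rw [G.potential_shift hH, ENNReal.ofReal_mul hr.le] at h
  rw [← ENNReal.mul_le_mul_iff_right hr0 ENNReal.ofReal_ne_top]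
  refine h.trans ?_
  rw [mul_add, ← mul_assoc, ← mul_assoc, ← ENNReal.ofReal_mul hr.le, ← ENNReal.ofReal_mul hr.le,
    mul_div_cancel₀ _ hr.ne', ← Finset.sum_add_sum_compl H]
  refine add_le_add ?_ ?_
  · rw [t, ENNReal.ofReal_sum_of_nonneg fun i _ => (G.time_pos i).le, Finset.sum_mul]
    refine Finset.sum_le_sum fun j hj => ?_
    rw [shift, if_pos hj, pow_zero, mul_one]
    exact mul_le_mul_right (le_iSup₂ (f := fun j _ => G.payoff s j) j hj) _
  · rw [t, Finset.mul_sum, ENNReal.ofReal_sum_of_nonneg fun i _ =>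
      (mul_pos hr (G.time_pos i)).le, Finset.sum_mul]
    refine Finset.sum_le_sum fun j hj => ?_
    rw [shift, if_neg (Finset.mem_compl.1 hj), mul_comm (G.time j)]
    exact mul_le_mul_right (le_iSup (fun j => G.payoff s j) j) _

/-! ### The vertices of the frontier -/

theorem v_sub_v_succ (k : ℕ) : G.v H k - G.v H (k + 1) = (1 - G.q) ^ k * G.t Hᶜ := by
  have hq := G.q_pos.ne'
  rw [v, v]
  field_simp
  ring

theorem outer_succ (k : ℕ) : G.outer H (k + 1) = G.outer H k + G.t H := by
  rw [outer, outer]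
  push_cast
  ring

theorem t_mul_v_add_t_mul_outer (hH : H.Nonempty) (hHc : Hᶜ.Nonempty) (k : ℕ) :
    G.t H / (1 - G.q) ^ k * G.v H k + G.t Hᶜ * G.outer H k = G.rhs H k := by
  have hq := G.q_pos.ne'
  have hr := (pow_pos G.r_pos k).ne'
  have hY := G.t_mul_V (hH.mono (Finset.subset_univ H))
  have h1 := G.t_mul_V hH
  have h2 := G.t_mul_V hHc
  have hsq : ∑ i, G.time i ^ 2 = ∑ i ∈ H, G.time i ^ 2 + ∑ i ∈ Hᶜ, G.time i ^ 2 :=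
    (Finset.sum_add_sum_compl H _).symm
  rw [hsq] at hY
  have hV : G.t Finset.univ * G.V Finset.univ = G.t H * G.V H + G.t Hᶜ * G.V Hᶜ +
      G.t H * G.t Hᶜ * (2 / G.q - 1) := by
    rw [hY, h1, h2, G.t_univ H]
    ring
  rw [rhs, hV, v, outer]
  field_simp
  ring

theorem t_mul_v_succ_add_t_mul_outer_succ (hH : H.Nonempty) (hHc : Hᶜ.Nonempty) (k : ℕ) :
    G.t H / (1 - G.q) ^ k * G.v H (k + 1) + G.t Hᶜ * G.outer H (k + 1) = G.rhs H k := by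
  have hr := (pow_pos G.r_pos k).ne'
  rw [← G.t_mul_v_add_t_mul_outer hH hHc k, outer_succ,
    show G.v H (k + 1) = G.v H k - (1 - G.q) ^ k * G.t Hᶜ by linarith [G.v_sub_v_succ (H := H) k]]
  field_simp
  ring

theorem rhs_zero (H : Finset (Fin n)) : G.rhs H 0 = G.t Finset.univ * G.V Finset.univ := by
  simp [rhs]

theorem meanArrival_le {Z : Finset (Fin n)} (hZ : Z.Nonempty) : G.meanArrival Z ≤ G.t Z := by
  have ht := G.t_pos hZ
  have h : (∑ i ∈ Z, G.time i ^ 2) / G.t Z ≤ G.t Z := by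
    rw [div_le_iff₀ ht, ← sq]
    exact G.sum_sq_le Z
  rw [meanArrival]
  linarith

theorem v_pos (hH : H.Nonempty) (hHc : Hᶜ.Nonempty) (k : ℕ) : 0 < G.v H k :=
  add_pos (G.V_pos hH) (mul_pos (div_pos (pow_pos G.r_pos k) G.q_pos) (G.t_pos hHc))

theorem outer_pos (hH : H.Nonempty) (hHc : Hᶜ.Nonempty) (k : ℕ) : 0 < G.outer H k :=
  add_pos_of_pos_of_nonneg (G.V_pos hHc) (mul_nonneg (add_nonneg (Nat.cast_nonneg k)
    (div_pos G.r_pos G.q_pos).le) (G.t_pos hH).le)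

theorem v_succ_le (hHc : Hᶜ.Nonempty) (k : ℕ) : G.v H (k + 1) ≤ G.v H k := by
  have := mul_pos (pow_pos G.r_pos k) (G.t_pos hHc)
  linarith [G.v_sub_v_succ (H := H) k]

theorem v_succ_le_outer_succ (hH : H.Nonempty) (hHc : Hᶜ.Nonempty) (k : ℕ) :
    G.v H (k + 1) ≤ G.outer H (k + 1) := by
  induction k with
  | zero =>
    have h1 := G.meanArrival_le hH
    have h2 := G.meanArrival_nonneg hHc
    rw [v, outer, G.V_eq_meanArrival hH, G.V_eq_meanArrival hHc]
    push_cast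
    rw [pow_one]
    linarith
  | succ k ih =>
    rw [outer_succ]
    linarith [G.v_succ_le hHc (k + 1), G.t_pos hH]

theorem outer_zero_le_v_zero (hH : H.Nonempty) (hHc : Hᶜ.Nonempty) :
    G.outer H 0 ≤ G.v H 0 := by
  have h1 := G.meanArrival_le hHc
  have h2 := G.meanArrival_nonneg hH
  have h3 : 1 / G.q = 1 + (1 - G.q) / G.q := by
    have := G.q_pos.ne'
    field_simp
    ring
  rw [v, outer, G.V_eq_meanArrival hH, G.V_eq_meanArrival hHc, pow_zero, h3]
  push_cast
  linarith

theorem V_univ_le_v_zero (hH : H.Nonempty) (hHc : Hᶜ.Nonempty) :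
    G.V Finset.univ ≤ G.v H 0 := by
  have h := G.t_mul_v_add_t_mul_outer hH hHc 0
  rw [rhs_zero, pow_zero, div_one, G.t_univ H] at h
  have h' := mul_le_mul_of_nonneg_left (G.outer_zero_le_v_zero hH hHc) (G.t_pos hHc).le
  have hT := add_pos (G.t_pos hH) (G.t_pos hHc)
  refine le_of_mul_le_mul_left ?_ hT
  linarith

theorem v_one_le_V_univ (hH : H.Nonempty) (hHc : Hᶜ.Nonempty) :
    G.v H 1 ≤ G.V Finset.univ := by
  have h := G.t_mul_v_succ_add_t_mul_outer_succ hH hHc 0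
  rw [rhs_zero, pow_zero, div_one, G.t_univ H, zero_add] at h
  have h' := mul_le_mul_of_nonneg_left (G.v_succ_le_outer_succ hH hHc 0) (G.t_pos hHc).le
  rw [zero_add] at h'
  have hT := add_pos (G.t_pos hH) (G.t_pos hHc)
  refine le_of_mul_le_mul_left ?_ hT
  linarith

/-- The minimum is attained because the expected payoff of the mixed search `s^k` against `h^k`
equals the lower bound. -/
theorem isLeast_payoffHider (hH : H.Nonempty) (hHc : Hᶜ.Nonempty) (k : ℕ) :
    IsLeast (Set.range fun S : ℕ → Fin n => G.payoffHider S (G.hider H k))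
      (ENNReal.ofReal (G.lam H k * G.rhs H k)) := by
  refine ⟨?_, ?_⟩
  · refine exists_eq_of_expect_eq (p := (G.sk H hH hHc k).1) ENNReal.ofReal_ne_top
      (G.le_payoffHider_hider hH k) ?_
    rw [expect_payoffHider, ← G.t_mul_v_add_t_mul_outer hH hHc k, ← sum_hider_mul,
      ENNReal.ofReal_sum_of_nonneg]
    · refine Finset.sum_congr rfl fun j _ => ?_
      rw [ENNReal.ofReal_mul (G.hider_nonneg hH k j)]
      congr 1
      split_ifs with hj
      · exact G.payoff_sk_of_mem hH hHc k hj
      · exact G.payoff_sk_of_notMem hH hHc k (Finset.mem_compl.2 hj)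
    · intro j _
      refine mul_nonneg (G.hider_nonneg hH k j) ?_
      split_ifs
      exacts [(G.v_pos hH hHc k).le, (G.outer_pos hH hHc k).le]
  · rintro _ ⟨S, rfl⟩
    exact G.le_payoffHider_hider hH k S

/-! ### Pareto optimality -/

theorem consistency_le_robustness (H : Finset (Fin n)) (s : MixedSearch n) :
    G.consistency H s ≤ G.robustness s :=
  iSup₂_le fun j _ => le_iSup (fun j => G.payoff s j) j

theorem consistency_eq (hH : H.Nonempty) {s : MixedSearch n} {c : ℝ≥0∞}
    (hc : ∀ j ∈ H, G.payoff s j = c) : G.consistency H s = c := by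
  rw [consistency, biSup_congr hc]
  exact biSup_const hH

theorem robustness_eq (hHc : Hᶜ.Nonempty) {s : MixedSearch n} {c o : ℝ≥0∞}
    (hc : ∀ j ∈ H, G.payoff s j = c) (ho : ∀ j ∈ Hᶜ, G.payoff s j = o) (hco : c ≤ o) :
    G.robustness s = o := by
  apply le_antisymm
  · refine iSup_le fun j => ?_
    by_cases hj : j ∈ H
    · exact (hc j hj).le.trans hco
    · exact (ho j (Finset.mem_compl.2 hj)).le
  · obtain ⟨j, hj⟩ := hHc
    rw [← ho j hj]
    exact le_iSup (fun j => G.payoff s j) j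

theorem rhs_le_toReal (hH : H.Nonempty) (hHc : Hᶜ.Nonempty) (k : ℕ) {s : MixedSearch n}
    (hs : G.robustness s ≠ ∞) :
    G.rhs H k ≤ G.t H / (1 - G.q) ^ k * (G.consistency H s).toReal +
      G.t Hᶜ * (G.robustness s).toReal := by
  have hC : G.consistency H s ≠ ∞ := ne_top_of_le_ne_top hs (G.consistency_le_robustness H s)
  have h1 : 0 ≤ G.t H / (1 - G.q) ^ k := (div_pos (G.t_pos hH) (pow_pos G.r_pos k)).le
  have h2 := (G.t_pos hHc).le
  have h := G.rhs_le hH k s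
  rw [← ENNReal.ofReal_toReal hC, ← ENNReal.ofReal_toReal hs, ← ENNReal.ofReal_mul h1,
    ← ENNReal.ofReal_mul h2, ← ENNReal.ofReal_add (mul_nonneg h1 ENNReal.toReal_nonneg)
    (mul_nonneg h2 ENNReal.toReal_nonneg)] at h
  exact (ENNReal.ofReal_le_ofReal_iff (add_nonneg (mul_nonneg h1 ENNReal.toReal_nonneg)
    (mul_nonneg h2 ENNReal.toReal_nonneg))).1 h

/-- Both coefficients of the `k`-th line are positive, so a search on the line is not dominated. -/
theorem paretoOptimal_of_eq_rhs (hH : H.Nonempty) (hHc : Hᶜ.Nonempty) (k : ℕ)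
    {s : MixedSearch n} (hs : G.robustness s ≠ ∞)
    (hline : G.t H / (1 - G.q) ^ k * (G.consistency H s).toReal +
      G.t Hᶜ * (G.robustness s).toReal = G.rhs H k) : G.ParetoOptimal H s := by
  rintro ⟨s', hC, hR, hlt⟩
  have hCs : G.consistency H s ≠ ∞ := ne_top_of_le_ne_top hs (G.consistency_le_robustness H s)
  have hs' : G.robustness s' ≠ ∞ := ne_top_of_le_ne_top hs hR
  have hCs' : G.consistency H s' ≠ ∞ := ne_top_of_le_ne_top hCs hC
  have h1 : 0 < G.t H / (1 - G.q) ^ k := div_pos (G.t_pos hH) (pow_pos G.r_pos k)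
  have h2 := G.t_pos hHc
  have h := G.rhs_le_toReal hH hHc k hs'
  have hC' := mul_le_mul_of_nonneg_left (ENNReal.toReal_mono hCs hC) h1.le
  have hR' := mul_le_mul_of_nonneg_left (ENNReal.toReal_mono hs hR) h2.le
  rcases hlt with hlt | hlt
  · have := mul_lt_mul_of_pos_left ((ENNReal.toReal_lt_toReal hCs' hCs).2 hlt) h1
    linarith
  · have := mul_lt_mul_of_pos_left ((ENNReal.toReal_lt_toReal hs' hs).2 hlt) h2
    linarith

/-- The convex combination of the `k`-th and the next vertex. -/
theorem combination_line (hH : H.Nonempty) (hHc : Hᶜ.Nonempty) (k : ℕ) (β : ℝ) :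
    G.t H / (1 - G.q) ^ k * ((1 - β) * G.v H k + β * G.v H (k + 1)) +
      G.t Hᶜ * ((1 - β) * G.outer H k + β * G.outer H (k + 1)) = G.rhs H k := by
  linear_combination (1 - β) * G.t_mul_v_add_t_mul_outer hH hHc k +
    β * G.t_mul_v_succ_add_t_mul_outer_succ hH hHc k

theorem combination_eq (k : ℕ) (β : ℝ) :
    (1 - β) * G.v H k + β * G.v H (k + 1) = G.v H k - β * ((1 - G.q) ^ k * G.t Hᶜ) := by
  rw [← v_sub_v_succ]
  ring

theorem combination_le_V_univ_iff (hHc : Hᶜ.Nonempty) (β : ℝ) :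
    (1 - β) * G.v H 0 + β * G.v H (0 + 1) ≤ G.V Finset.univ ↔ G.betaStar H ≤ β := by
  have ht := G.t_pos hHc
  have h : G.betaStar H = (G.v H 0 - G.V Finset.univ) / G.t Hᶜ := by
    rw [betaStar, v]
    field_simp
    ring
  rw [combination_eq, h, div_le_iff₀ ht, pow_zero, one_mul, sub_le_iff_le_add, sub_le_iff_le_add']

/-- The consistency and the robustness of `s^k(β)`. -/
theorem consistency_robustness_skMix (hH : H.Nonempty) (hHc : Hᶜ.Nonempty) (k : ℕ)
    (β : unitInterval) (hk : 1 ≤ k ∨ G.betaStar H ≤ β) :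
    (G.consistency H (G.skMix H hH hHc k β) =
      ENNReal.ofReal ((1 - β) * G.v H k + β * G.v H (k + 1))) ∧
    G.robustness (G.skMix H hH hHc k β) =
      ENNReal.ofReal ((1 - β) * G.outer H k + β * G.outer H (k + 1)) := by
  have h1 : (0 : ℝ) ≤ 1 - β := sub_nonneg.2 β.2.2
  have h2 : (0 : ℝ) ≤ β := β.2.1
  have hc : ∀ j ∈ H, G.payoff (G.skMix H hH hHc k β) j =
      ENNReal.ofReal ((1 - β) * G.v H k + β * G.v H (k + 1)) := fun j hj =>
    G.payoff_mix β _ _ j (G.v_pos hH hHc k).le (G.v_pos hH hHc _).le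
      (G.payoff_sk_of_mem hH hHc k hj) (G.payoff_sk_of_mem hH hHc _ hj)
  have ho : ∀ j ∈ Hᶜ, G.payoff (G.skMix H hH hHc k β) j =
      ENNReal.ofReal ((1 - β) * G.outer H k + β * G.outer H (k + 1)) := fun j hj =>
    G.payoff_mix β _ _ j (G.outer_pos hH hHc k).le (G.outer_pos hH hHc _).le
      (G.payoff_sk_of_notMem hH hHc k hj) (G.payoff_sk_of_notMem hH hHc _ hj)
  refine ⟨G.consistency_eq hH hc, G.robustness_eq hHc hc ho (ENNReal.ofReal_le_ofReal ?_)⟩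
  by_cases hk1 : 1 ≤ k
  · obtain ⟨k, rfl⟩ := Nat.exists_eq_add_of_le' hk1
    exact add_le_add (mul_le_mul_of_nonneg_left (G.v_succ_le_outer_succ hH hHc k) h1)
      (mul_le_mul_of_nonneg_left (G.v_succ_le_outer_succ hH hHc (k + 1)) h2)
  -- On the line with index `0`, consistency at most `V_q(Y)` means robustness at least `V_q(Y)`.
  · obtain rfl : k = 0 := by omega
    have hV := (G.combination_le_V_univ_iff hHc β).2 (hk.resolve_left hk1)
    have hl := G.combination_line hH hHc 0 β
    rw [rhs_zero, pow_zero, div_one, G.t_univ H] at hl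
    refine hV.trans (le_of_mul_le_mul_left ?_ (G.t_pos hHc))
    linarith [mul_le_mul_of_nonneg_left hV (G.t_pos hH).le]

theorem point_skMix (hH : H.Nonempty) (hHc : Hᶜ.Nonempty) (k : ℕ) (β : unitInterval)
    (hk : 1 ≤ k ∨ G.betaStar H ≤ β) :
    G.point H (G.skMix H hH hHc k β) = ((1 - β) * G.v H k + β * G.v H (k + 1),
      (1 - β) * G.outer H k + β * G.outer H (k + 1)) := by
  have h1 : (0 : ℝ) ≤ 1 - β := sub_nonneg.2 β.2.2
  have h2 : (0 : ℝ) ≤ β := β.2.1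
  obtain ⟨hC, hR⟩ := G.consistency_robustness_skMix hH hHc k β hk
  rw [point, hC, hR, ENNReal.toReal_ofReal, ENNReal.toReal_ofReal]
  · exact add_nonneg (mul_nonneg h1 (G.outer_pos hH hHc _).le)
      (mul_nonneg h2 (G.outer_pos hH hHc _).le)
  · exact add_nonneg (mul_nonneg h1 (G.v_pos hH hHc _).le) (mul_nonneg h2 (G.v_pos hH hHc _).le)

theorem robustness_skMix_ne_top (hH : H.Nonempty) (hHc : Hᶜ.Nonempty) (k : ℕ)
    (β : unitInterval) (hk : 1 ≤ k ∨ G.betaStar H ≤ β) :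
    G.robustness (G.skMix H hH hHc k β) ≠ ∞ := by
  rw [(G.consistency_robustness_skMix hH hHc k β hk).2]
  exact ENNReal.ofReal_ne_top

theorem paretoOptimal_skMix (hH : H.Nonempty) (hHc : Hᶜ.Nonempty) (k : ℕ) (β : unitInterval)
    (hk : 1 ≤ k ∨ G.betaStar H ≤ β) : G.ParetoOptimal H (G.skMix H hH hHc k β) := by
  refine G.paretoOptimal_of_eq_rhs hH hHc k (G.robustness_skMix_ne_top hH hHc k β hk) ?_
  have hp := G.point_skMix hH hHc k β hk
  rw [point, Prod.mk.injEq] at hp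
  rw [hp.1, hp.2]
  exact G.combination_line hH hHc k β

theorem combination_mem_Icc (hHc : Hᶜ.Nonempty) (k : ℕ) (β : unitInterval) :
    G.v H (k + 1) ≤ (1 - β) * G.v H k + β * G.v H (k + 1) ∧
      (1 - β) * G.v H k + β * G.v H (k + 1) ≤ G.v H k := by
  have h := sub_nonneg.2 (G.v_succ_le hHc k)
  have h1 : (0 : ℝ) ≤ 1 - β := sub_nonneg.2 β.2.2
  have h2 : (0 : ℝ) ≤ β := β.2.1
  constructor
  · linarith [mul_nonneg h1 h]
  · linarith [mul_nonneg h2 h]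

theorem exists_combination_eq (hHc : Hᶜ.Nonempty) {k : ℕ} {c : ℝ} (h1 : G.v H (k + 1) ≤ c)
    (h2 : c ≤ G.v H k) :
    ∃ β : unitInterval, (1 - β) * G.v H k + β * G.v H (k + 1) = c := by
  have hd : 0 < (1 - G.q) ^ k * G.t Hᶜ := mul_pos (pow_pos G.r_pos k) (G.t_pos hHc)
  have hv := G.v_sub_v_succ (H := H) k
  refine ⟨⟨(G.v H k - c) / ((1 - G.q) ^ k * G.t Hᶜ), div_nonneg (sub_nonneg.2 h2) hd.le,
    (div_le_one hd).2 (by linarith)⟩, ?_⟩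
  rw [combination_eq]
  change G.v H k - (G.v H k - c) / ((1 - G.q) ^ k * G.t Hᶜ) * ((1 - G.q) ^ k * G.t Hᶜ) = c
  rw [div_mul_cancel₀ _ hd.ne']
  ring

/-- A point on the `k`-th line is determined by its first coordinate. -/
theorem eq_of_line (hHc : Hᶜ.Nonempty) {a c o o' ρ : ℝ} (h : a * c + G.t Hᶜ * o = ρ)
    (h' : a * c + G.t Hᶜ * o' = ρ) : o = o' :=
  mul_left_cancel₀ (G.t_pos hHc).ne' (by linarith)

theorem range_point_skMix (hH : H.Nonempty) (hHc : Hᶜ.Nonempty) {k : ℕ} (hk : 1 ≤ k) :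
    (Set.range fun β : unitInterval => G.point H (G.skMix H hH hHc k β)) = G.kthSegment H k := by
  ext ⟨c, o⟩
  constructor
  · rintro ⟨β, hβ⟩
    rw [← hβ]
    simp only [G.point_skMix hH hHc k β (Or.inl hk)]
    exact ⟨G.combination_line hH hHc k β, G.combination_mem_Icc hHc k β⟩
  · rintro ⟨hl, h1, h2⟩
    obtain ⟨β, rfl⟩ := G.exists_combination_eq hHc h1 h2
    refine ⟨β, ?_⟩
    simp only [G.point_skMix hH hHc k β (Or.inl hk)]
    exact Prod.ext rfl (G.eq_of_line hHc (G.combination_line hH hHc k β) hl)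

theorem image_point_skMix (hH : H.Nonempty) (hHc : Hᶜ.Nonempty) :
    (fun β : unitInterval => G.point H (G.skMix H hH hHc 0 β)) '' {β | G.betaStar H ≤ β} =
      G.firstSegment H := by
  have hline : ∀ c o : ℝ, G.t H / (1 - G.q) ^ 0 * c + G.t Hᶜ * o = G.rhs H 0 ↔
      G.t H * c + G.t Hᶜ * o = G.t Finset.univ * G.V Finset.univ := fun c o => by
    rw [pow_zero, div_one, rhs_zero]
  ext ⟨c, o⟩
  constructor
  · rintro ⟨β, hb, hβ⟩
    rw [← hβ]
    simp only [G.point_skMix hH hHc 0 β (Or.inr hb)]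
    exact ⟨(hline _ _).1 (G.combination_line hH hHc 0 β), (G.combination_mem_Icc hHc 0 β).1,
      (G.combination_le_V_univ_iff hHc β).2 hb⟩
  · rintro ⟨hl, h1, h2⟩
    obtain ⟨β, rfl⟩ := G.exists_combination_eq (k := 0) hHc h1
      (h2.trans (G.V_univ_le_v_zero hH hHc))
    have hb := (G.combination_le_V_univ_iff hHc β).1 h2
    refine ⟨β, hb, ?_⟩
    simp only [G.point_skMix hH hHc 0 β (Or.inr hb)]
    exact Prod.ext rfl (G.eq_of_line hHc (G.combination_line hH hHc 0 β) ((hline _ _).2 hl))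

/-! ### The frontier -/

/-- Consistency equal to `V_q(H)` is impossible for finite robustness: the right-hand sides of the
lines grow too fast. -/
theorem V_lt_consistency (hH : H.Nonempty) (hHc : Hᶜ.Nonempty) {s : MixedSearch n}
    (hs : G.robustness s ≠ ∞) : G.V H < (G.consistency H s).toReal := by
  by_contra! hle
  have h1 := G.t_pos hH
  have h2 := G.t_pos hHc
  obtain ⟨k, hk⟩ := exists_nat_gt ((G.t Hᶜ * (G.robustness s).toReal + G.t H * G.V H -
    G.t Finset.univ * G.V Finset.univ) / (G.t H * G.t Hᶜ))
  rw [div_lt_iff₀ (mul_pos h1 h2)] at hk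
  have hr := pow_pos G.r_pos k
  have h := G.rhs_le_toReal hH hHc k hs
  have hc := mul_le_mul_of_nonneg_left hle (div_pos h1 hr).le
  have hrhs : G.rhs H k = G.t Finset.univ * G.V Finset.univ +
      (G.t H / (1 - G.q) ^ k * G.V H - G.t H * G.V H) + k * (G.t H * G.t Hᶜ) := by
    rw [rhs]
    field_simp
  linarith

/-- The abscissas `v_k` of the vertices decrease to `V_q(H)`, so the intervals between them cover
everything above `V_q(H)`. -/
theorem exists_v_succ_le (H : Finset (Fin n)) {c : ℝ} (h1 : G.V H < c) (h2 : c ≤ G.v H 0) :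
    ∃ k, G.v H (k + 1) ≤ c ∧ c ≤ G.v H k := by
  have hlim : Filter.Tendsto (G.v H) Filter.atTop (nhds (G.V H)) := by
    have h := (((tendsto_pow_atTop_nhds_zero_of_lt_one G.r_pos.le G.r_lt_one).div_const
      G.q).mul_const (G.t Hᶜ)).const_add (G.V H)
    rwa [zero_div, zero_mul, add_zero] at h
  have hex : ∃ k, G.v H k < c := (hlim.eventually (gt_mem_nhds h1)).exists
  classical
  have hpos : Nat.find hex ≠ 0 := by
    intro h0
    have := Nat.find_spec hex
    rw [h0] at this
    exact absurd this (not_lt.2 h2)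
  obtain ⟨k, hk⟩ := Nat.exists_eq_succ_of_ne_zero hpos
  refine ⟨k, ?_, ?_⟩
  · have := Nat.find_spec hex
    rw [hk] at this
    exact this.le
  · exact not_lt.1 (Nat.find_min hex (by rw [hk]; exact Nat.lt_succ_self k))

theorem V_univ_le_robustness (hH : H.Nonempty) (hHc : Hᶜ.Nonempty) {s : MixedSearch n}
    (hs : G.robustness s ≠ ∞) : G.V Finset.univ ≤ (G.robustness s).toReal := by
  have h := G.rhs_le_toReal hH hHc 0 hs
  rw [rhs_zero, pow_zero, div_one, G.t_univ H] at h
  have hC := mul_le_mul_of_nonneg_left (ENNReal.toReal_mono hs (G.consistency_le_robustness H s))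
    (G.t_pos hH).le
  refine le_of_mul_le_mul_left ?_ (add_pos (G.t_pos hH) (G.t_pos hHc))
  linarith

/-- Every mixed search with finite robustness is weakly dominated by some `s^k(β)`. -/
theorem exists_skMix_le (hH : H.Nonempty) (hHc : Hᶜ.Nonempty) {s : MixedSearch n}
    (hs : G.robustness s ≠ ∞) :
    ∃ (k : ℕ) (β : unitInterval), (1 ≤ k ∨ G.betaStar H ≤ β) ∧
      G.consistency H (G.skMix H hH hHc k β) ≤ G.consistency H s ∧
      G.robustness (G.skMix H hH hHc k β) ≤ G.robustness s := by
  have h2 := G.t_pos hHc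
  -- Consistency above `V_q(Y)` is of no use, so a search with larger consistency is compared with
  -- the search whose consistency and robustness are both `V_q(Y)`.
  obtain ⟨k, c, hk1, hk2, hcV, hcC, hrhs⟩ : ∃ (k : ℕ) (c : ℝ), G.v H (k + 1) ≤ c ∧
      c ≤ G.v H k ∧ c ≤ G.V Finset.univ ∧ c ≤ (G.consistency H s).toReal ∧
      G.rhs H k ≤ G.t H / (1 - G.q) ^ k * c + G.t Hᶜ * (G.robustness s).toReal := by
    rcases le_total (G.consistency H s).toReal (G.V Finset.univ) with h | h
    · obtain ⟨k, hk1, hk2⟩ := G.exists_v_succ_le H (G.V_lt_consistency hH hHc hs)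
        (h.trans (G.V_univ_le_v_zero hH hHc))
      exact ⟨k, _, hk1, hk2, h, le_rfl, G.rhs_le_toReal hH hHc k hs⟩
    · refine ⟨0, G.V Finset.univ, G.v_one_le_V_univ hH hHc, G.V_univ_le_v_zero hH hHc, le_rfl, h,
        ?_⟩
      rw [rhs_zero, pow_zero, div_one, G.t_univ H]
      linarith [mul_le_mul_of_nonneg_left (G.V_univ_le_robustness hH hHc hs) h2.le]
  obtain ⟨β, hβ⟩ := G.exists_combination_eq hHc hk1 hk2
  have hadm : 1 ≤ k ∨ G.betaStar H ≤ β := by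
    rcases Nat.eq_zero_or_pos k with rfl | hk
    · exact Or.inr ((G.combination_le_V_univ_iff hHc β).1 (hβ.trans_le hcV))
    · exact Or.inl hk
  obtain ⟨hC', hR'⟩ := G.consistency_robustness_skMix hH hHc k β hadm
  have hline := G.combination_line hH hHc k β
  rw [hβ] at hC' hline
  refine ⟨k, β, hadm, ?_, ?_⟩
  · rw [hC']
    exact ENNReal.ofReal_le_of_le_toReal hcC
  · rw [hR']
    refine ENNReal.ofReal_le_of_le_toReal (le_of_mul_le_mul_left ?_ h2)
    linarith

theorem paretoFrontier_eq (hH : H.Nonempty) (hHc : Hᶜ.Nonempty) :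
    G.paretoFrontier H = (⋃ (k : ℕ) (_ : 1 ≤ k), G.kthSegment H k) ∪ G.firstSegment H := by
  have hmem : ∀ (k : ℕ) (β : unitInterval), 1 ≤ k ∨ G.betaStar H ≤ β →
      G.point H (G.skMix H hH hHc k β) ∈
        (⋃ (k : ℕ) (_ : 1 ≤ k), G.kthSegment H k) ∪ G.firstSegment H := by
    intro k β hadm
    by_cases hk : 1 ≤ k
    · refine Or.inl (Set.mem_iUnion₂.2 ⟨k, hk, ?_⟩)
      rw [← G.range_point_skMix hH hHc hk]
      exact ⟨β, rfl⟩
    · obtain rfl : k = 0 := by omega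
      refine Or.inr ?_
      rw [← G.image_point_skMix hH hHc]
      exact ⟨β, hadm.resolve_left hk, rfl⟩
  apply Set.Subset.antisymm
  · rintro p ⟨s, hs, hfin, rfl⟩
    obtain ⟨k, β, hadm, hC, hR⟩ := G.exists_skMix_le hH hHc hfin
    have hCeq : G.consistency H (G.skMix H hH hHc k β) = G.consistency H s :=
      hC.eq_of_not_lt fun h => hs ⟨_, hC, hR, Or.inl h⟩
    have hReq : G.robustness (G.skMix H hH hHc k β) = G.robustness s :=
      hR.eq_of_not_lt fun h => hs ⟨_, hC, hR, Or.inr h⟩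
    have := hmem k β hadm
    rwa [point, hCeq, hReq] at this
  · rintro p (hp | hp)
    · obtain ⟨k, hk, hp⟩ := Set.mem_iUnion₂.1 hp
      rw [← G.range_point_skMix hH hHc hk] at hp
      obtain ⟨β, rfl⟩ := hp
      exact ⟨_, G.paretoOptimal_skMix hH hHc k β (Or.inl hk),
        G.robustness_skMix_ne_top hH hHc k β (Or.inl hk), rfl⟩
    · rw [← G.image_point_skMix hH hHc] at hp
      obtain ⟨β, hβ, rfl⟩ := hp
      exact ⟨_, G.paretoOptimal_skMix hH hHc 0 β (Or.inr hβ),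
        G.robustness_skMix_ne_top hH hHc 0 β (Or.inr hβ), rfl⟩

end BoxSearch

theorem mainTheorem2 (n : ℕ) (G : BoxSearch n) (H : Finset (Fin n))
    (hH : H.Nonempty) (hHc : Hᶜ.Nonempty) :
    -- `V_q(Z)` is the value of the game on the boxes of `Z`
    (∀ Z : Finset (Fin n), Z.Nonempty → G.HasValue Z (G.V Z)) ∧
    -- the Pareto frontier
    G.paretoFrontier H = (⋃ (k : ℕ) (_ : 1 ≤ k), G.kthSegment H k) ∪ G.firstSegment H ∧
    -- the frontier is achieved by the searches `s^k(β)`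
    (∀ k : ℕ, 1 ≤ k →
      (∀ β : unitInterval, G.ParetoOptimal H (G.skMix H hH hHc k β) ∧
        G.robustness (G.skMix H hH hHc k β) ≠ ⊤) ∧
      (Set.range fun β : unitInterval => G.point H (G.skMix H hH hHc k β)) = G.kthSegment H k) ∧
    ((∀ β : unitInterval, G.betaStar H ≤ β → G.ParetoOptimal H (G.skMix H hH hHc 0 β) ∧
        G.robustness (G.skMix H hH hHc 0 β) ≠ ⊤) ∧
      (fun β : unitInterval => G.point H (G.skMix H hH hHc 0 β)) '' {β | G.betaStar H ≤ β} =
        G.firstSegment H) ∧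
    -- tightness: the hiding distribution `h^k` and the lower bound that it gives
    (∀ k : ℕ, G.hider H k ∈ stdSimplex ℝ (Fin n) ∧
      IsLeast (Set.range fun S : ℕ → Fin n => G.payoffHider S (G.hider H k))
        (ENNReal.ofReal (G.lam H k * G.rhs H k)) ∧
      ∀ s : MixedSearch n, ENNReal.ofReal (G.rhs H k) ≤
        ENNReal.ofReal (G.t H / (1 - G.q) ^ k) * G.consistency H s +
          ENNReal.ofReal (G.t Hᶜ) * G.robustness s) := by
  exact ⟨fun Z hZ => G.hasValue_V hZ, G.paretoFrontier_eq hH hHc,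
    fun k hk => ⟨fun β => ⟨G.paretoOptimal_skMix hH hHc k β (Or.inl hk),
      G.robustness_skMix_ne_top hH hHc k β (Or.inl hk)⟩, G.range_point_skMix hH hHc hk⟩,
    ⟨fun β hβ => ⟨G.paretoOptimal_skMix hH hHc 0 β (Or.inr hβ),
      G.robustness_skMix_ne_top hH hHc 0 β (Or.inr hβ)⟩, G.image_point_skMix hH hHc⟩,
    fun k => ⟨G.hider_mem hH k, G.isLeast_payoffHider hH hHc k, G.rhs_le hH k⟩⟩
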